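/- Let $\mathcal{L}_+=\{k\in\mathbb{R}^4 : -(k^0)^2+|\boldsymbol{k}|^2=0,\ k^0>0\}$ be the forward lightcone, which is identified with $\mathbb{R}^3\setminus\{0\}$ through its spatial part $\boldsymbol{k}$. The graviton bundle $\Xi\subset\mathcal{L}_+\times\mathbb{C}^{3\times 3}$ is the bundle over $\mathcal{L}_+$ with fibers $$\Xi(k)=\{A\in\mathbb{C}^{3\times3} : A^{T}=A,\ \operatorname{tr}A=0,\ A\boldsymbol{k}=0\}.$$ Let $R_{\boldsymbol{k}}(\psi)\in SO(3)$ be the right-handed rotation by the angle $\psi$ about the axis $\boldsymbol{k}$. The R and L circularly polarized bundles $\Xi_+$ and $\Xi_-$ are the subbundles of $\Xi$ of helicity $+2$ and $-2$, that is, $$\Xi_\pm(k)=\{A\in\Xi(k) : R_{\boldsymbol{k}}(\psi)\,A\,R_{\boldsymbol{k}}(\psi)^{-1}=e^{\mp 2i\psi}A\ \text{ for all }\psi\in\mathbb{R}\}.$$ For a smooth complex vector bundle $E$ over $\mathcal{L}_+$, the first Chern number is that of its restriction to the unit sphere $S^2\subset\mathbb{R}^3\setminus\{0\}\cong\mathcal{L}_+$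 (oriented by the outward normal): $C_1(E)=\frac{i}{2\pi}\int_{S^2}\operatorname{tr}\Omega$, where $\Omega$ is the curvature of any smooth connection on $E$. Then $\Xi$ is a smooth complex vector bundle of rank $2$ and is topologically trivial, i.e. isomorphic as a topological complex vector bundle to $\mathcal{L}_+\times\mathbb{C}^2$. The bundles $\Xi_+$ and $\Xi_-$ are smooth complex line bundles, neither of which is topologically trivial, and their first Chern numbers are $$C_1(\Xi_\pm)=\mp4 .$$ -/

import Mathlib

open scoped ContDiff Topology Matrix

attribute [local instance] Matrix.normedAddCommGroup Matrix.normedSpace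

noncomputable section

/-! ### Complex vector subbundles of a trivial bundle, and their triviality -/

/-- The total space of the family of fibers `E b ⊆ V`, `b ∈ B`, topologized as a subspace of
`X × V`. -/
abbrev BundleTotalSpace {X V : Type*} [AddCommGroup V] [Module ℂ V]
    (B : Set X) (E : X → Submodule ℂ V) : Type _ :=
  {p : X × V // p.1 ∈ B ∧ p.2 ∈ E p.1}

/-- The bundle with fibers `E b`, `b ∈ B`, is isomorphic, as a topological complex vector bundle
over `B`, to the trivial bundle `B × ℂ ^ r`: there is a homeomorphism of the total spaces over `B`
that is `ℂ`-linear on each fiber. -/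
def IsTopologicallyTrivial {X V : Type*} [TopologicalSpace X] [NormedAddCommGroup V]
    [NormedSpace ℂ V] (r : ℕ) (B : Set X) (E : X → Submodule ℂ V) : Prop :=
  ∃ Φ : BundleTotalSpace B E ≃ₜ B × (Fin r → ℂ),
    (∀ p, ((Φ p).1 : X) = p.1.1) ∧
    ∀ (b : X) (hb : b ∈ B),
      IsLinearMap ℂ (fun w : E b => (Φ ⟨(b, (w : V)), hb, w.2⟩).2)

/-- Over `M` (an open set of a normed space), the fibers `E x ⊆ V` form a smooth complex
vector bundle of rank `r`: there are local smooth frames near every point. -/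
def IsSmoothBundle {X V : Type*} [NormedAddCommGroup X] [NormedSpace ℝ X] [NormedAddCommGroup V]
    [NormedSpace ℂ V] (r : ℕ) (M : Set X) (E : X → Submodule ℂ V) : Prop :=
  ∀ x ∈ M, ∃ U : Set X, IsOpen U ∧ x ∈ U ∧ U ⊆ M ∧ ∃ e : Fin r → X → V,
    (∀ i, ContDiffOn ℝ ∞ (e i) U) ∧
    ∀ y ∈ U, LinearIndependent ℂ (fun i => e i y) ∧
      Submodule.span ℂ (Set.range fun i => e i y) = E y

/-! ### Connections, curvature and the first Chern number -/

/-- `s` is, near `x`, a smooth section of the bundle with fibers `E y`. -/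
def IsSmoothSectionNear {X V : Type*} [NormedAddCommGroup X] [NormedSpace ℝ X]
    [NormedAddCommGroup V] [NormedSpace ℂ V] (E : X → Submodule ℂ V) (s : X → V) (x : X) : Prop :=
  ∀ᶠ y in 𝓝 x, ContDiffAt ℝ ∞ s y ∧ s y ∈ E y

/-- A smooth (Koszul) connection on the complex vector bundle with fibers `E x`, over an open set
`M` of a normed space; `cov s x v` is the covariant derivative at `x` of the section `s` in the
direction `v`. As in Mathlib's covariant derivatives, `cov` is a total function, whose values are
only meaningful at the points near which `s` is a smooth section. -/
structure SmoothConnection {X V : Type*} [NormedAddCommGroup X] [NormedSpace ℝ X]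
    [NormedAddCommGroup V] [NormedSpace ℂ V] (M : Set X) (E : X → Submodule ℂ V) where
  cov : (X → V) → X → X →L[ℝ] V
  mem : ∀ x ∈ M, ∀ s, IsSmoothSectionNear E s x → ∀ v, cov s x v ∈ E x
  smooth : ∀ x ∈ M, ∀ s, IsSmoothSectionNear E s x → ContDiffAt ℝ ∞ (cov s) x
  add : ∀ x ∈ M, ∀ s t, IsSmoothSectionNear E s x → IsSmoothSectionNear E t x →
    cov (fun y => s y + t y) x = cov s x + cov t x
  leibniz : ∀ x ∈ M, ∀ (f : X → ℂ) (s : X → V), (∀ᶠ y in 𝓝 x, ContDiffAt ℝ ∞ f y) →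
    IsSmoothSectionNear E s x → ∀ v,
    cov (fun y => f y • s y) x v = (fderiv ℝ f x v) • s x + f x • cov s x v

/-- `Ω` is the curvature of the connection `D`:
`Ω(u, v) s = D_u (D_v s) - D_v (D_u s)` for constant (hence commuting) vector fields `u`, `v`. -/
def IsCurvature {X V : Type*} [NormedAddCommGroup X] [NormedSpace ℝ X]
    [NormedAddCommGroup V] [NormedSpace ℂ V] {M : Set X} {E : X → Submodule ℂ V}
    (D : SmoothConnection M E) (Ω : (x : X) → X → X → Module.End ℂ (E x)) : Prop :=
  ∀ x ∈ M, ∀ (s : X → V) (hs : s x ∈ E x), IsSmoothSectionNear E s x → ∀ u v : X,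
    (Ω x u v ⟨s x, hs⟩ : V) =
      D.cov (fun y => D.cov s y v) x u - D.cov (fun y => D.cov s y u) x v

/-- Spherical coordinates on the unit sphere in `ℝ³` (`θ` the polar angle, `φ` the azimuth). -/
def spherePoint (θ φ : ℝ) : Fin 3 → ℝ :=
  ![Real.sin θ * Real.cos φ, Real.sin θ * Real.sin φ, Real.cos θ]

/-- The integral over the unit sphere in `ℝ³`, oriented by the outward normal (that is, by
`dθ ∧ dφ`), of the restriction of a complex 2-form `β`. -/
def sphereIntegral (β : (Fin 3 → ℝ) → (Fin 3 → ℝ) → (Fin 3 → ℝ) → ℂ) : ℂ :=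
  ∫ θ in (0 : ℝ)..Real.pi, ∫ φ in (0 : ℝ)..(2 * Real.pi),
    β (spherePoint θ φ) (deriv (fun t => spherePoint t φ) θ) (deriv (fun t => spherePoint θ t) φ)

/-- The integer `c` is the first Chern number of the restriction to the unit sphere of the
smooth complex vector bundle with fibers `E x` over `ℝ³ ∖ {0}`: connections exist, and
`(i / 2π) ∫ tr Ω = c` for the curvature `Ω` of each of them. (Every connection of the bundle
restricted to the sphere is the restriction of one over `ℝ³ ∖ {0}`, and the curvature of the
restriction is the restriction of the curvature.) -/
def IsFirstChernNumber {V : Type*} [NormedAddCommGroup V] [NormedSpace ℂ V]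
    (E : (Fin 3 → ℝ) → Submodule ℂ V) (c : ℤ) : Prop :=
  (∃ (D : SmoothConnection {0}ᶜ E) (Ω : (x : Fin 3 → ℝ) → (Fin 3 → ℝ) → (Fin 3 → ℝ) →
      Module.End ℂ (E x)), IsCurvature D Ω) ∧
  ∀ (D : SmoothConnection {0}ᶜ E) (Ω : (x : Fin 3 → ℝ) → (Fin 3 → ℝ) → (Fin 3 → ℝ) →
      Module.End ℂ (E x)), IsCurvature D Ω →
    (Complex.I / (2 * (Real.pi : ℂ))) *
      sphereIntegral (fun x u v => LinearMap.trace ℂ (E x) (Ω x u v)) = (c : ℂ)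

/-! ### The lightcone and the graviton bundles -/

/-- The forward lightcone (without the origin): `k^μ k_μ = 0` for the signature `(-,+,+,+)`,
with positive frequency `k^0`. -/
def forwardLightcone : Set (Fin 4 → ℝ) :=
  {k | -(k 0) ^ 2 + (k 1) ^ 2 + (k 2) ^ 2 + (k 3) ^ 2 = 0 ∧ 0 < k 0}

/-- The spatial part of a four-vector. -/
def spatialPart (k : Fin 4 → ℝ) : Fin 3 → ℝ := fun i => k i.succ

/-- The parametrization `x ↦ (|x|, x)` of the forward lightcone by `ℝ³ ∖ {0}`; it is the inverse of
the spatial part, and it gives the lightcone its smooth structure. -/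
def lightconePoint (x : Fin 3 → ℝ) : Fin 4 → ℝ := Fin.cons (Real.sqrt (x ⬝ᵥ x)) x

/-- The fiber at `k` of the graviton bundle `Ξ`: complex symmetric traceless tensors `A^{ij}` on
`ℂ³` with `A^{ij} k_j = 0`. -/
def graviton (k : Fin 4 → ℝ) : Submodule ℂ (Matrix (Fin 3) (Fin 3) ℂ) where
  carrier := {A | Aᵀ = A ∧ A.trace = 0 ∧ A *ᵥ (fun i => (spatialPart k i : ℂ)) = 0}
  zero_mem' := by simp
  add_mem' := by
    rintro A B ⟨h1, h2, h3⟩ ⟨h4, h5, h6⟩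
    exact ⟨by rw [Matrix.transpose_add, h1, h4], by rw [Matrix.trace_add, h2, h5, add_zero],
      by rw [Matrix.add_mulVec, h3, h6, add_zero]⟩
  smul_mem' := by
    rintro c A ⟨h1, h2, h3⟩
    exact ⟨by rw [Matrix.transpose_smul, h1], by rw [Matrix.trace_smul, h2, smul_zero],
      by rw [Matrix.smul_mulVec, h3, smul_zero]⟩

/-- The (right-handed) rotation of `ℝ³` by the angle `ψ` about the axis of `k ≠ 0`, by
Rodrigues' formula. -/
def axisRotation (k : Fin 3 → ℝ) (ψ : ℝ) : Matrix (Fin 3) (Fin 3) ℝ :=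
  let n : Fin 3 → ℝ := (Real.sqrt (k ⬝ᵥ k))⁻¹ • k
  Real.cos ψ • (1 : Matrix (Fin 3) (Fin 3) ℝ)
    + Real.sin ψ • !![0, -n 2, n 1; n 2, 0, -n 0; -n 1, n 0, 0]
    + (1 - Real.cos ψ) • Matrix.vecMulVec n n

/-- The action `A ↦ R A R⁻¹ = R A Rᵀ` of a rotation `R` on complex tensors. -/
def rotateTensor (R : Matrix (Fin 3) (Fin 3) ℝ) (A : Matrix (Fin 3) (Fin 3) ℂ) :
    Matrix (Fin 3) (Fin 3) ℂ :=
  R.map Complex.ofReal * A * (R.map Complex.ofReal)ᵀ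

/-- The fiber at `k` of the bundle of gravitons of helicity `h`: the `A ∈ Ξ(k)` on which the
rotation by each angle `ψ` about the axis of `k` acts as multiplication by `exp (-i h ψ)`.
The R and L circularly polarized bundles `Ξ₊` and `Ξ₋` are those of helicity `2` and `-2`. -/
def helicityGraviton (h : ℤ) (k : Fin 4 → ℝ) : Submodule ℂ (Matrix (Fin 3) (Fin 3) ℂ) where
  carrier := {A | A ∈ graviton k ∧ ∀ ψ : ℝ, rotateTensor (axisRotation (spatialPart k) ψ) A =
    Complex.exp (-(Complex.I * (h : ℂ) * (ψ : ℂ))) • A}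
  zero_mem' := ⟨(graviton k).zero_mem, fun ψ => by simp [rotateTensor]⟩
  add_mem' := by
    rintro A B ⟨h1, h2⟩ ⟨h3, h4⟩
    refine ⟨(graviton k).add_mem h1 h3, fun ψ => ?_⟩
    rw [smul_add, ← h2 ψ, ← h4 ψ]
    simp [rotateTensor, Matrix.mul_add, Matrix.add_mul]
  smul_mem' := by
    rintro c A ⟨h1, h2⟩
    refine ⟨(graviton k).smul_mem c h1, fun ψ => ?_⟩
    rw [smul_comm, ← h2 ψ]
    simp [rotateTensor]

/-- The R circularly polarized graviton bundle `Ξ₊`. -/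
def rightGraviton : (Fin 4 → ℝ) → Submodule ℂ (Matrix (Fin 3) (Fin 3) ℂ) := helicityGraviton 2

/-- The L circularly polarized graviton bundle `Ξ₋`. -/
def leftGraviton : (Fin 4 → ℝ) → Submodule ℂ (Matrix (Fin 3) (Fin 3) ℂ) := helicityGraviton (-2)

end

/-!
Both polarized bundles are eigenbundles of the cross product: a tensor `A` has helicity `2ε`,
`ε = ±1`, at `x` iff `A` is symmetric and `x × A = -iε|x| A` (`mem_helicityGraviton_iff`). The vectors
with `x × m = -iε|x| m` form a line, so the tensors of helicity `2ε` form the line spanned by `m mᵀ`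
(`IsCircularTensor.smul_eq`). Two choices of `m` which are polynomial in `x` and `|x|`, and vanish on
opposite half-axes, give frames over the complements of these half-axes (`isLineFrame_polFrame`).

*Chern numbers.* In a local frame a connection is given by a one-form `η`, and the trace of its
curvature is `dη` (`IsLineFrame.trace_curvature`). Stokes' theorem on the two hemispheres
(`integral_extDeriv₁_sphere`) reduces the integral to the difference of the two forms `η` along the
equator, which is the logarithmic derivative of the transition function. Thus the Chern number is the
winding number of the transition function (`isFirstChernNumber_of_isLineFrame`). Stereographic
coordinates at the two poles are inverse to each other, and tensors are quartic in spinors, so the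
transition function is `exp (-4iεφ)` on the equator.

*Nontriviality.* A nowhere vanishing section has a coordinate, with respect to the square of
`e_θ + iε e_φ`, that is a nonvanishing function `f` of the spherical coordinates `(θ, φ)`. The loops
`φ ↦ f (θ, φ)` are then all homotopic in `ℂ ∖ {0}`, but their winding number is `2ε` at one pole and
`-2ε` at the other (`not_isTopologicallyTrivial_circular`).

*Triviality of the graviton bundle.* It is the sum of the two polarized bundles, of opposite degrees
`∓4`. With a spinor `(z, w)` of `x`, and tensors `s₊`, `s₋` of helicity `±2` that are quartic in
`(z, w)` and in its conjugate, the tensors `z̄⁴ s₊ - w⁴ s₋` and `w̄⁴ s₊ + z⁴ s₋` only depend on `x`.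
They are orthogonal, of squared length proportional to `|z|⁸ + |w|⁸ > 0`, so that they form a global
frame (`gravitonFrame`).
-/

/-! ### Connections on a line bundle in a local frame -/

section Connection

variable {X V : Type*} [NormedAddCommGroup X] [NormedSpace ℝ X] [NormedAddCommGroup V]
  [NormedSpace ℂ V] {M : Set X} {E : X → Submodule ℂ V}

theorem IsSmoothSectionNear.eventually {s : X → V} {x : X} (h : IsSmoothSectionNear E s x) :
    ∀ᶠ y in 𝓝 x, IsSmoothSectionNear E s y :=
  eventually_eventually_nhds.2 h

theorem IsSmoothSectionNear.contDiffAt {s : X → V} {x : X} (h : IsSmoothSectionNear E s x) :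
    ContDiffAt ℝ ∞ s x :=
  h.self_of_nhds.1

theorem IsSmoothSectionNear.mem {s : X → V} {x : X} (h : IsSmoothSectionNear E s x) :
    s x ∈ E x :=
  h.self_of_nhds.2

theorem IsSmoothSectionNear.smul {s : X → V} {x : X} {f : X → ℂ}
    (hf : ∀ᶠ y in 𝓝 x, ContDiffAt ℝ ∞ f y) (h : IsSmoothSectionNear E s x) :
    IsSmoothSectionNear E (fun y => f y • s y) x := by
  filter_upwards [hf, h] with y h1 h2
  exact ⟨h1.smul h2.1, (E y).smul_mem _ h2.2⟩

/-- A connection is a local operator: by the Leibniz rule for a bump function. -/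
theorem SmoothConnection.cov_congr [FiniteDimensional ℝ X] (D : SmoothConnection M E) {x : X}
    (hx : x ∈ M) {s t : X → V} (hs : IsSmoothSectionNear E s x) (ht : IsSmoothSectionNear E t x)
    (hst : s =ᶠ[𝓝 x] t) : D.cov s x = D.cov t x := by
  obtain ⟨R, hR, hball⟩ := Metric.eventually_nhds_iff_ball.1 hst
  let b : ContDiffBump x := ⟨R / 2, R, by positivity, by linarith⟩
  let f : X → ℂ := fun y => (b y : ℂ)
  have hf : ∀ y, ContDiffAt ℝ ∞ f y := fun y =>
    (Complex.ofRealCLM.contDiff.comp b.contDiff).contDiffAt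
  have hfx : f x = 1 := by
    have : b x = 1 := b.one_of_mem_closedBall (Metric.mem_closedBall_self b.rIn_pos.le)
    simp [f, this]
  have hfun : (fun y => f y • s y) = fun y => f y • t y := by
    funext y
    by_cases hy : y ∈ Metric.ball x R
    · rw [hball y hy]
    · have : b y = 0 := b.zero_of_le_dist (by simpa using hy)
      simp [f, this]
  ext v
  have h1 := D.leibniz x hx f s (.of_forall hf) hs v
  have h2 := D.leibniz x hx f t (.of_forall hf) ht v
  rw [hfun, h2, hfx, hst.self_of_nhds] at h1
  simpa using h1.symm

theorem SmoothConnection.isSmoothSectionNear_cov (hM : IsOpen M) (D : SmoothConnection M E) {x : X}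
    (hx : x ∈ M) {s : X → V} (hs : IsSmoothSectionNear E s x) (v : X) :
    IsSmoothSectionNear E (fun y => D.cov s y v) x := by
  filter_upwards [hM.mem_nhds hx, hs.eventually] with y hy hsy
  exact ⟨(D.smooth y hy s hsy).clm_apply contDiffAt_const, D.mem y hy s hsy v⟩

/-- A local frame `s` of a line bundle on the open set `U`, together with a linear functional `ℓ`
on the ambient vector space that reads off the coordinate with respect to `s`. -/
structure IsLineFrame (E : X → Submodule ℂ V) (U : Set X) (s : X → V) (ℓ : V →L[ℂ] ℂ) : Prop where
  isOpen : IsOpen U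
  contDiffOn : ContDiffOn ℝ ∞ s U
  mem : ∀ x ∈ U, s x ∈ E x
  coord : ∀ x ∈ U, ℓ (s x) = 1
  eq_smul : ∀ x ∈ U, ∀ A ∈ E x, A = ℓ A • s x

/-- The exterior derivative of a one-form on a normed space. -/
noncomputable def extDeriv₁ (η : X → X →L[ℝ] ℂ) (x u v : X) : ℂ :=
  fderiv ℝ η x u v - fderiv ℝ η x v u

/-- The connection form of the connection `D` in the frame `s` with coordinate functional `ℓ`. -/
noncomputable def connectionForm (D : SmoothConnection M E) (s : X → V) (ℓ : V →L[ℂ] ℂ) (x : X) :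
    X →L[ℝ] ℂ :=
  (ℓ.restrictScalars ℝ).comp (D.cov s x)

namespace IsLineFrame

variable {U : Set X} {s : X → V} {ℓ : V →L[ℂ] ℂ}

theorem isSmoothSectionNear (F : IsLineFrame E U s ℓ) {x : X} (hx : x ∈ U) :
    IsSmoothSectionNear E s x := by
  filter_upwards [F.isOpen.mem_nhds hx] with y hy
  exact ⟨F.contDiffOn.contDiffAt (F.isOpen.mem_nhds hy), F.mem y hy⟩

theorem span_eq (F : IsLineFrame E U s ℓ) {x : X} (hx : x ∈ U) :
    Submodule.span ℂ {s x} = E x := by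
  apply le_antisymm
  · rw [Submodule.span_singleton_le_iff_mem]
    exact F.mem x hx
  · intro A hA
    rw [F.eq_smul x hx A hA]
    exact Submodule.smul_mem _ _ (Submodule.mem_span_singleton_self _)

theorem ne_zero (F : IsLineFrame E U s ℓ) {x : X} (hx : x ∈ U) : s x ≠ 0 := by
  intro h
  have := F.coord x hx
  simp [h] at this

theorem exists_smooth_frame (F : IsLineFrame E U s ℓ) (hU : U ⊆ M) {x : X} (hx : x ∈ U) :
    ∃ U : Set X, IsOpen U ∧ x ∈ U ∧ U ⊆ M ∧ ∃ e : Fin 1 → X → V,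
      (∀ i, ContDiffOn ℝ ∞ (e i) U) ∧
      ∀ y ∈ U, LinearIndependent ℂ (fun i => e i y) ∧
        Submodule.span ℂ (Set.range fun i => e i y) = E y := by
  refine ⟨U, F.isOpen, hx, hU, fun _ => s, fun _ => F.contDiffOn, fun y hy => ⟨?_, ?_⟩⟩
  · exact linearIndependent_unique_iff.2 (F.ne_zero hy)
  · rw [Set.range_const, F.span_eq hy]

theorem cov_eq (F : IsLineFrame E U s ℓ) (hU : U ⊆ M) (D : SmoothConnection M E) {x : X}
    (hx : x ∈ U) (v : X) : D.cov s x v = connectionForm D s ℓ x v • s x :=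
  F.eq_smul x hx _ (D.mem x (hU hx) s (F.isSmoothSectionNear hx) v)

theorem contDiffAt_connectionForm (F : IsLineFrame E U s ℓ) (hU : U ⊆ M)
    (D : SmoothConnection M E) {x : X} (hx : x ∈ U) :
    ContDiffAt ℝ ∞ (connectionForm D s ℓ) x :=
  contDiffAt_const.clm_comp (D.smooth x (hU hx) s (F.isSmoothSectionNear hx))

theorem eventuallyEq_smul (F : IsLineFrame E U s ℓ) {x : X} (hx : x ∈ U) {t : X → V}
    (ht : IsSmoothSectionNear E t x) : t =ᶠ[𝓝 x] fun y => ℓ (t y) • s y := by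
  filter_upwards [F.isOpen.mem_nhds hx, ht] with y hy hty
  exact F.eq_smul y hy _ hty.2

theorem contDiffAt_coord {t : X → V} {x : X} (ht : IsSmoothSectionNear E t x) :
    ∀ᶠ y in 𝓝 x, ContDiffAt ℝ ∞ (fun z => ℓ (t z)) y := by
  filter_upwards [ht] with y hy
  exact (ℓ.restrictScalars ℝ).contDiff.contDiffAt.comp y hy.1

variable [FiniteDimensional ℝ X]

theorem cov_section_eq (F : IsLineFrame E U s ℓ) (hU : U ⊆ M) (D : SmoothConnection M E) {x : X}
    (hx : x ∈ U) {t : X → V} (ht : IsSmoothSectionNear E t x) (v : X) :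
    D.cov t x v =
      (fderiv ℝ (fun y => ℓ (t y)) x v + ℓ (t x) * connectionForm D s ℓ x v) • s x := by
  have hs := F.isSmoothSectionNear hx
  rw [D.cov_congr (hU hx) ht (hs.smul (contDiffAt_coord ht)) (F.eventuallyEq_smul hx ht),
    D.leibniz x (hU hx) _ s (contDiffAt_coord ht) hs v, F.cov_eq hU D hx, smul_smul, add_smul]

/-- The curvature acts on sections as multiplication by the exterior derivative of the connection
form. -/
theorem curvature_eq (F : IsLineFrame E U s ℓ) (hM : IsOpen M) (hU : U ⊆ M)
    (D : SmoothConnection M E) {x : X}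
    (hx : x ∈ U) {t : X → V} (ht : IsSmoothSectionNear E t x) (u v : X) :
    D.cov (fun y => D.cov t y v) x u - D.cov (fun y => D.cov t y u) x v =
      extDeriv₁ (connectionForm D s ℓ) x u v • t x := by
  set η := connectionForm D s ℓ with hη
  set f : X → ℂ := fun y => ℓ (t y) with hf
  have hfx : ContDiffAt ℝ ∞ f x := (contDiffAt_coord (ℓ := ℓ) ht).self_of_nhds
  have hηx : ContDiffAt ℝ ∞ η x := F.contDiffAt_connectionForm hU D hx
  have hdf : DifferentiableAt ℝ f x := hfx.differentiableAt (by simp)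
  have hdη : DifferentiableAt ℝ η x := hηx.differentiableAt (by simp)
  have hddf : DifferentiableAt ℝ (fderiv ℝ f) x :=
    (hfx.fderiv_right (m := 1) (by norm_cast)).differentiableAt (by simp)
  have hcoord : ∀ v : X, (fun y => ℓ (D.cov t y v)) =ᶠ[𝓝 x]
      fun y => fderiv ℝ f y v + f y * η y v := by
    intro v
    filter_upwards [F.isOpen.mem_nhds hx, ht.eventually] with y hy hty
    rw [F.cov_section_eq hU D hy hty, map_smul, F.coord y hy, smul_eq_mul, mul_one]
  have key : ∀ u v : X, D.cov (fun y => D.cov t y v) x u =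
      (fderiv ℝ (fderiv ℝ f) x u v + (f x * fderiv ℝ η x u v + fderiv ℝ f x u * η x v)
        + (fderiv ℝ f x v + f x * η x v) * η x u) • s x := by
    intro u v
    have hv : ℓ (D.cov t x v) = fderiv ℝ f x v + f x * η x v := (hcoord v).self_of_nhds
    rw [F.cov_section_eq hU D hx (D.isSmoothSectionNear_cov hM (hU hx) ht v) u,
      (hcoord v).fderiv_eq, hv]
    have h1 : HasFDerivAt (fun y => fderiv ℝ f y v + f y * η y v) _ x :=
      (hddf.hasFDerivAt.clm_apply (hasFDerivAt_const v x)).add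
        (hdf.hasFDerivAt.mul (hdη.hasFDerivAt.clm_apply (hasFDerivAt_const v x)))
    rw [h1.fderiv]
    congr 1
    simp
    ring
  have hsymm : fderiv ℝ (fderiv ℝ f) x u v = fderiv ℝ (fderiv ℝ f) x v u :=
    (hfx.isSymmSndFDerivAt (by simp [minSmoothness_of_isRCLikeNormedField]; norm_cast)) u v
  rw [key u v, key v u, ← sub_smul, hsymm]
  conv_rhs => rw [F.eq_smul x hx (t x) ht.mem, smul_smul]
  congr 1
  simp only [extDeriv₁]
  ring

theorem trace_curvature (F : IsLineFrame E U s ℓ) (hM : IsOpen M) (hU : U ⊆ M)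
    {D : SmoothConnection M E} {Ω : (x : X) → X → X → Module.End ℂ (E x)} (hΩ : IsCurvature D Ω)
    {x : X} (hx : x ∈ U) (u v : X) :
    LinearMap.trace ℂ (E x) (Ω x u v) = extDeriv₁ (connectionForm D s ℓ) x u v := by
  have h1 : Ω x u v = extDeriv₁ (connectionForm D s ℓ) x u v • LinearMap.id := by
    ext w
    have hs := F.isSmoothSectionNear hx
    have ht : IsSmoothSectionNear E (fun y => ℓ (w : V) • s y) x :=
      hs.smul (.of_forall fun y => contDiffAt_const)
    have hw : (w : V) = ℓ (w : V) • s x := F.eq_smul x hx w w.2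
    have h2 := hΩ x (hU hx) _ ht.mem ht u v
    rw [F.curvature_eq hM hU D hx ht] at h2
    have h3 : (⟨ℓ (w : V) • s x, ht.mem⟩ : E x) = w := Subtype.ext hw.symm
    rw [h3, ← hw] at h2
    simpa using h2
  have h2 : Module.finrank ℂ (E x) = 1 := by
    rw [← F.span_eq hx]
    exact finrank_span_singleton (F.ne_zero hx)
  have : Module.Finite ℂ (E x) := Module.finite_of_finrank_eq_succ h2
  rw [h1, map_smul, LinearMap.trace_id, h2]
  simp

end IsLineFrame

/-- A smooth family of projections onto the fibers of a bundle gives a connection: differentiate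
in the ambient vector space and project. -/
noncomputable def projectedConnection (P : X → V →L[ℂ] V) (hP : ∀ x ∈ M, ContDiffAt ℝ ∞ P x)
    (hmem : ∀ x ∈ M, ∀ A, P x A ∈ E x) (hid : ∀ x ∈ M, ∀ A ∈ E x, P x A = A) :
    SmoothConnection M E where
  cov s x := ((P x).restrictScalars ℝ).comp (fderiv ℝ s x)
  mem x hx s _ v := hmem x hx _
  smooth x hx s hs := by
    have h1 : ContDiffAt ℝ ∞ (fun y => (P y).restrictScalars ℝ) x :=
      (ContinuousLinearMap.restrictScalarsL ℂ V V ℝ ℝ).contDiff.contDiffAt.comp x (hP x hx)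
    exact h1.clm_comp (hs.contDiffAt.fderiv_right (by simp))
  add x hx s t hs ht := by
    rw [fderiv_fun_add (hs.contDiffAt.differentiableAt (by simp))
      (ht.contDiffAt.differentiableAt (by simp))]
    ext v
    simp
  leibniz x hx f s hf hs v := by
    have h1 := (hf.self_of_nhds.differentiableAt (by simp)).hasFDerivAt.smul
      (hs.contDiffAt.differentiableAt (by simp)).hasFDerivAt
    have h2 : fderiv ℝ (fun y => f y • s y) x = _ := h1.fderiv
    rw [h2]
    simp [hid x hx _ hs.mem, add_comm]

end Connection

/-! ### Spherical coordinates and Stokes' theorem on zones of the sphere -/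

section Sphere

/-- The coordinate vector field `∂/∂θ` along the sphere. -/
noncomputable def sphereTheta (θ φ : ℝ) : Fin 3 → ℝ :=
  ![Real.cos θ * Real.cos φ, Real.cos θ * Real.sin φ, -Real.sin θ]

/-- The coordinate vector field `∂/∂φ` along the sphere. -/
noncomputable def spherePhi (θ φ : ℝ) : Fin 3 → ℝ :=
  ![-(Real.sin θ * Real.sin φ), Real.sin θ * Real.cos φ, 0]

/-- The mixed second derivative of the spherical coordinates. -/
noncomputable def sphereThetaPhi (θ φ : ℝ) : Fin 3 → ℝ :=
  ![-(Real.cos θ * Real.sin φ), Real.cos θ * Real.cos φ, 0]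

theorem hasDerivAt_spherePoint_theta (θ φ : ℝ) :
    HasDerivAt (fun t => spherePoint t φ) (sphereTheta θ φ) θ := by
  rw [hasDerivAt_pi]
  intro i
  fin_cases i
  · exact (Real.hasDerivAt_sin θ).mul_const _
  · exact (Real.hasDerivAt_sin θ).mul_const _
  · exact Real.hasDerivAt_cos θ

theorem hasDerivAt_spherePoint_phi (θ φ : ℝ) :
    HasDerivAt (fun t => spherePoint θ t) (spherePhi θ φ) φ := by
  rw [hasDerivAt_pi]
  intro i
  fin_cases i
  · simpa [spherePoint, spherePhi] using (Real.hasDerivAt_cos φ).const_mul (Real.sin θ)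
  · exact (Real.hasDerivAt_sin φ).const_mul _
  · exact hasDerivAt_const _ _

theorem hasDerivAt_spherePhi (θ φ : ℝ) :
    HasDerivAt (fun t => spherePhi t φ) (sphereThetaPhi θ φ) θ := by
  rw [hasDerivAt_pi]
  intro i
  fin_cases i
  · exact ((Real.hasDerivAt_sin θ).mul_const _).neg
  · exact (Real.hasDerivAt_sin θ).mul_const _
  · exact hasDerivAt_const _ _

theorem hasDerivAt_sphereTheta (θ φ : ℝ) :
    HasDerivAt (fun t => sphereTheta θ t) (sphereThetaPhi θ φ) φ := by
  rw [hasDerivAt_pi]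
  intro i
  fin_cases i
  · simpa [sphereTheta, sphereThetaPhi] using (Real.hasDerivAt_cos φ).const_mul (Real.cos θ)
  · exact (Real.hasDerivAt_sin φ).const_mul _
  · exact hasDerivAt_const _ _

theorem contDiff_spherePoint : ContDiff ℝ ∞ fun q : ℝ × ℝ => spherePoint q.1 q.2 := by
  rw [contDiff_pi]
  intro i
  fin_cases i <;> simp [spherePoint] <;> fun_prop

theorem contDiff_sphereTheta : ContDiff ℝ ∞ fun q : ℝ × ℝ => sphereTheta q.1 q.2 := by
  rw [contDiff_pi]
  intro i
  fin_cases i <;> simp [sphereTheta] <;> fun_prop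

theorem contDiff_spherePhi : ContDiff ℝ ∞ fun q : ℝ × ℝ => spherePhi q.1 q.2 := by
  rw [contDiff_pi]
  intro i
  fin_cases i <;> simp [spherePhi] <;> fun_prop

theorem spherePoint_ne_zero (θ φ : ℝ) : spherePoint θ φ ≠ 0 := by
  intro h
  have h0 : Real.sin θ * Real.cos φ = 0 := congrFun h 0
  have h1 : Real.sin θ * Real.sin φ = 0 := congrFun h 1
  have h2 : Real.cos θ = 0 := congrFun h 2
  have h3 := Real.sin_sq_add_cos_sq θ
  have h4 := Real.sin_sq_add_cos_sq φ
  have : Real.sin θ ^ 2 = 0 := by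
    linear_combination (Real.sin θ * Real.cos φ) * h0 + (Real.sin θ * Real.sin φ) * h1
      - Real.sin θ ^ 2 * h4
  rw [this, h2] at h3
  norm_num at h3

theorem spherePhi_zero (φ : ℝ) : spherePhi 0 φ = 0 := by
  ext i
  fin_cases i <;> simp [spherePhi]

theorem spherePhi_pi (φ : ℝ) : spherePhi Real.pi φ = 0 := by
  ext i
  fin_cases i <;> simp [spherePhi]

theorem fderiv_prod_fst {F : Type*} [NormedAddCommGroup F] [NormedSpace ℝ F] {f : ℝ × ℝ → F}
    {q : ℝ × ℝ} {f' : F} (hf : DifferentiableAt ℝ f q)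
    (h : HasDerivAt (fun t => f (t, q.2)) f' q.1) : fderiv ℝ f q (1, 0) = f' :=
  (hf.hasFDerivAt.comp_hasDerivAt q.1
    ((hasDerivAt_id q.1).prodMk (hasDerivAt_const q.1 q.2))).unique h

theorem fderiv_prod_snd {F : Type*} [NormedAddCommGroup F] [NormedSpace ℝ F] {f : ℝ × ℝ → F}
    {q : ℝ × ℝ} {f' : F} (hf : DifferentiableAt ℝ f q)
    (h : HasDerivAt (fun t => f (q.1, t)) f' q.2) : fderiv ℝ f q (0, 1) = f' :=
  (hf.hasFDerivAt.comp_hasDerivAt q.2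
    ((hasDerivAt_const q.2 q.1).prodMk (hasDerivAt_id q.2))).unique h

variable {η : (Fin 3 → ℝ) → (Fin 3 → ℝ) →L[ℝ] ℂ}

theorem continuousAt_extDeriv₁_sphere {q : ℝ × ℝ}
    (hη : ContDiffAt ℝ ∞ η (spherePoint q.1 q.2)) :
    ContinuousAt (fun q : ℝ × ℝ => extDeriv₁ η (spherePoint q.1 q.2) (sphereTheta q.1 q.2)
      (spherePhi q.1 q.2)) q := by
  have h1 : ContinuousAt (fderiv ℝ η) (spherePoint q.1 q.2) :=
    (hη.fderiv_right (m := 1) (by norm_cast)).continuousAt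
  have h2 : ContinuousAt (fun q : ℝ × ℝ => fderiv ℝ η (spherePoint q.1 q.2)) q :=
    ContinuousAt.comp (f := fun q : ℝ × ℝ => spherePoint q.1 q.2) h1
      contDiff_spherePoint.continuous.continuousAt
  have h3 := contDiff_sphereTheta.continuous.continuousAt (x := q)
  have h4 := contDiff_spherePhi.continuous.continuousAt (x := q)
  exact ((h2.clm_apply h3).clm_apply h4).sub ((h2.clm_apply h4).clm_apply h3)

/-- Stokes' theorem for a one-form on the zone `θ₀ ≤ θ ≤ θ₁` of the unit sphere. -/
theorem integral_extDeriv₁_sphere {U : Set (Fin 3 → ℝ)} (hη : ∀ x ∈ U, ContDiffAt ℝ ∞ η x)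
    {θ₀ θ₁ : ℝ} (hθ : θ₀ ≤ θ₁) (hU : ∀ θ ∈ Set.Icc θ₀ θ₁, ∀ φ, spherePoint θ φ ∈ U) :
    ∫ θ in θ₀..θ₁, ∫ φ in (0 : ℝ)..(2 * Real.pi),
        extDeriv₁ η (spherePoint θ φ) (sphereTheta θ φ) (spherePhi θ φ) =
      (∫ φ in (0 : ℝ)..(2 * Real.pi), η (spherePoint θ₁ φ) (spherePhi θ₁ φ)) -
        ∫ φ in (0 : ℝ)..(2 * Real.pi), η (spherePoint θ₀ φ) (spherePhi θ₀ φ) := by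
  let β : ℝ × ℝ → ℂ := fun q => η (spherePoint q.1 q.2) (spherePhi q.1 q.2)
  let α : ℝ × ℝ → ℂ := fun q => η (spherePoint q.1 q.2) (sphereTheta q.1 q.2)
  have hdη : ∀ q : ℝ × ℝ, q.1 ∈ Set.Icc θ₀ θ₁ →
      DifferentiableAt ℝ η (spherePoint q.1 q.2) := fun q hq =>
    (hη _ (hU _ hq _)).differentiableAt (by simp)
  have hdX : ∀ q : ℝ × ℝ, DifferentiableAt ℝ (fun q : ℝ × ℝ => spherePoint q.1 q.2) q :=
    fun q => contDiff_spherePoint.contDiffAt.differentiableAt (by simp)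
  have hdηX : ∀ q : ℝ × ℝ, q.1 ∈ Set.Icc θ₀ θ₁ →
      DifferentiableAt ℝ (fun q : ℝ × ℝ => η (spherePoint q.1 q.2)) q := fun q hq =>
    DifferentiableAt.comp (f := fun q : ℝ × ℝ => spherePoint q.1 q.2) q (hdη q hq) (hdX q)
  have hdβ : ∀ q : ℝ × ℝ, q.1 ∈ Set.Icc θ₀ θ₁ → DifferentiableAt ℝ β q := fun q hq =>
    (hdηX q hq).clm_apply (contDiff_spherePhi.contDiffAt.differentiableAt (by simp))
  have hdα : ∀ q : ℝ × ℝ, q.1 ∈ Set.Icc θ₀ θ₁ → DifferentiableAt ℝ α q := fun q hq =>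
    (hdηX q hq).clm_apply (contDiff_sphereTheta.contDiffAt.differentiableAt (by simp))
  have hXθ : ∀ q : ℝ × ℝ, q.1 ∈ Set.Icc θ₀ θ₁ →
      HasDerivAt (fun t => η (spherePoint t q.2))
        (fderiv ℝ η (spherePoint q.1 q.2) (sphereTheta q.1 q.2)) q.1 := fun q hq =>
    HasFDerivAt.comp_hasDerivAt (f := fun t => spherePoint t q.2) q.1 (hdη q hq).hasFDerivAt
      (hasDerivAt_spherePoint_theta q.1 q.2)
  have hXφ : ∀ q : ℝ × ℝ, q.1 ∈ Set.Icc θ₀ θ₁ →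
      HasDerivAt (fun t => η (spherePoint q.1 t))
        (fderiv ℝ η (spherePoint q.1 q.2) (spherePhi q.1 q.2)) q.2 := fun q hq =>
    HasFDerivAt.comp_hasDerivAt (f := fun t => spherePoint q.1 t) q.2 (hdη q hq).hasFDerivAt
      (hasDerivAt_spherePoint_phi q.1 q.2)
  have hβ : ∀ q : ℝ × ℝ, q.1 ∈ Set.Icc θ₀ θ₁ → fderiv ℝ β q (1, 0) =
      fderiv ℝ η (spherePoint q.1 q.2) (sphereTheta q.1 q.2) (spherePhi q.1 q.2)
        + η (spherePoint q.1 q.2) (sphereThetaPhi q.1 q.2) := fun q hq =>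
    fderiv_prod_fst (hdβ q hq) ((hXθ q hq).clm_apply (hasDerivAt_spherePhi q.1 q.2))
  have hα : ∀ q : ℝ × ℝ, q.1 ∈ Set.Icc θ₀ θ₁ → fderiv ℝ α q (0, 1) =
      fderiv ℝ η (spherePoint q.1 q.2) (spherePhi q.1 q.2) (sphereTheta q.1 q.2)
        + η (spherePoint q.1 q.2) (sphereThetaPhi q.1 q.2) := fun q hq =>
    fderiv_prod_snd (hdα q hq) ((hXφ q hq).clm_apply (hasDerivAt_sphereTheta q.1 q.2))
  have hd : ∀ q : ℝ × ℝ, q.1 ∈ Set.Icc θ₀ θ₁ →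
      fderiv ℝ β q (1, 0) + (-fderiv ℝ α q) (0, 1) =
        extDeriv₁ η (spherePoint q.1 q.2) (sphereTheta q.1 q.2) (spherePhi q.1 q.2) := by
    intro q hq
    rw [neg_apply, hβ q hq, hα q hq, extDeriv₁]
    ring
  have hmem : ∀ q ∈ Set.uIcc θ₀ θ₁ ×ˢ Set.uIcc 0 (2 * Real.pi), q.1 ∈ Set.Icc θ₀ θ₁ := by
    intro q hq
    rw [Set.uIcc_of_le hθ] at hq
    exact hq.1
  have hmem' : ∀ q ∈ Set.Ioo (min θ₀ θ₁) (max θ₀ θ₁) ×ˢ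
      Set.Ioo (min 0 (2 * Real.pi)) (max 0 (2 * Real.pi)), q.1 ∈ Set.Icc θ₀ θ₁ := by
    intro q hq
    rw [min_eq_left hθ, max_eq_right hθ] at hq
    exact Set.Ioo_subset_Icc_self hq.1
  have hcont : ContinuousOn (fun q => fderiv ℝ β q (1, 0) + (-fderiv ℝ α q) (0, 1))
      (Set.uIcc θ₀ θ₁ ×ˢ Set.uIcc 0 (2 * Real.pi)) := by
    refine ContinuousOn.congr (fun q hq => ContinuousAt.continuousWithinAt ?_)
      fun q hq => hd q (hmem q hq)
    exact continuousAt_extDeriv₁_sphere (hη _ (hU _ (hmem q hq) _))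
  have key := MeasureTheory.integral2_divergence_prod_of_hasFDerivAt β (fun q => -α q)
    (fderiv ℝ β) (fun q => -fderiv ℝ α q) θ₀ 0 θ₁ (2 * Real.pi)
    (fun q hq => (hdβ q (hmem q hq)).continuousAt.continuousWithinAt)
    (fun q hq => (hdα q (hmem q hq)).continuousAt.neg.continuousWithinAt)
    (fun q hq => (hdβ q (hmem' q hq)).hasFDerivAt)
    (fun q hq => (hdα q (hmem' q hq)).hasFDerivAt.neg)
    (hcont.integrableOn_compact (isCompact_uIcc.prod isCompact_uIcc))
  -- The two sides `φ = 0` and `φ = 2π` of the coordinate rectangle cancel.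
  have hper : ∀ θ, α (θ, 2 * Real.pi) = α (θ, 0) := by
    intro θ
    simp [α, spherePoint, sphereTheta]
  simp only [hper] at key
  rw [sub_self, zero_add] at key
  rw [← key]
  refine intervalIntegral.integral_congr fun θ hθ' => intervalIntegral.integral_congr fun φ _ => ?_
  rw [Set.uIcc_of_le hθ] at hθ'
  exact (hd (θ, φ) hθ').symm

end Sphere

/-! ### The Chern number as a winding number -/

section Chern

variable {V : Type*} [NormedAddCommGroup V] [NormedSpace ℂ V] {E : (Fin 3 → ℝ) → Submodule ℂ V}
  {U₀ U₁ : Set (Fin 3 → ℝ)} {s₀ s₁ : (Fin 3 → ℝ) → V} {ℓ₀ ℓ₁ : V →L[ℂ] ℂ}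

theorem sphereIntegral_eq (β : (Fin 3 → ℝ) → (Fin 3 → ℝ) → (Fin 3 → ℝ) → ℂ) :
    sphereIntegral β = ∫ θ in (0 : ℝ)..Real.pi, ∫ φ in (0 : ℝ)..(2 * Real.pi),
      β (spherePoint θ φ) (sphereTheta θ φ) (spherePhi θ φ) := by
  unfold sphereIntegral
  simp only [(hasDerivAt_spherePoint_theta _ _).deriv, (hasDerivAt_spherePoint_phi _ _).deriv]

/-- The connection forms in two frames differ by the logarithmic derivative of the transition
function `g`; here, along the equator, for `g = exp (i c φ)` there. -/
theorem connectionForm_sub_equator (hU₀ : IsLineFrame E U₀ s₀ ℓ₀) (hU₁ : IsLineFrame E U₁ s₁ ℓ₁)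
    (h0 : U₀ ⊆ {0}ᶜ) (h1 : U₁ ⊆ {0}ᶜ) (D : SmoothConnection {0}ᶜ E) {c : ℤ}
    (hg : ∀ φ : ℝ, ℓ₀ (s₁ (spherePoint (Real.pi / 2) φ)) = Complex.exp (Complex.I * c * φ))
    {φ : ℝ} (hx0 : spherePoint (Real.pi / 2) φ ∈ U₀) (hx1 : spherePoint (Real.pi / 2) φ ∈ U₁) :
    connectionForm D s₁ ℓ₁ (spherePoint (Real.pi / 2) φ) (spherePhi (Real.pi / 2) φ) -
      connectionForm D s₀ ℓ₀ (spherePoint (Real.pi / 2) φ) (spherePhi (Real.pi / 2) φ) =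
        Complex.I * c := by
  have hs := hU₁.isSmoothSectionNear hx1
  have e1 := congrArg ℓ₀ (hU₀.cov_section_eq h0 D hx0 hs (spherePhi (Real.pi / 2) φ))
  rw [hU₁.cov_eq h1 D hx1, map_smul, map_smul, hU₀.coord _ hx0, hg, smul_eq_mul, smul_eq_mul,
    mul_one] at e1
  have hd : DifferentiableAt ℝ (fun y => ℓ₀ (s₁ y)) (spherePoint (Real.pi / 2) φ) :=
    (IsLineFrame.contDiffAt_coord (ℓ := ℓ₀) hs).self_of_nhds.differentiableAt (by simp)
  have e2 : HasDerivAt (fun t : ℝ => ℓ₀ (s₁ (spherePoint (Real.pi / 2) t)))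
      (fderiv ℝ (fun y => ℓ₀ (s₁ y)) (spherePoint (Real.pi / 2) φ) (spherePhi (Real.pi / 2) φ)) φ :=
    HasFDerivAt.comp_hasDerivAt (f := fun t => spherePoint (Real.pi / 2) t) φ hd.hasFDerivAt
      (hasDerivAt_spherePoint_phi (Real.pi / 2) φ)
  have e3 : HasDerivAt (fun t : ℝ => Complex.exp (Complex.I * c * t))
      (Complex.exp (Complex.I * c * φ) * (Complex.I * c)) φ := by
    have : HasDerivAt (fun t : ℝ => Complex.I * c * (t : ℂ)) (Complex.I * c) φ := by
      simpa using (Complex.ofRealCLM.hasDerivAt (x := φ)).const_mul (Complex.I * c)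
    exact this.cexp
  simp only [hg] at e2
  rw [e2.unique e3] at e1
  have hne := Complex.exp_ne_zero (Complex.I * c * φ)
  apply mul_right_cancel₀ hne
  linear_combination e1

/-- The first Chern number of a line bundle over `ℝ³ ∖ {0}` is the winding number of the transition
function, along the equator, from a frame over the northern hemisphere to a frame over the southern
one. The sections `w₀` and `w₁`, which amount to `s₀` and `s₁` cut off by a partition of unity, only
serve to provide a connection. -/
theorem isFirstChernNumber_of_isLineFrame (hU₀ : IsLineFrame E U₀ s₀ ℓ₀)
    (hU₁ : IsLineFrame E U₁ s₁ ℓ₁) (hcov : U₀ ∪ U₁ = {0}ᶜ)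
    (hN : ∀ θ ∈ Set.Icc 0 (Real.pi / 2), ∀ φ, spherePoint θ φ ∈ U₀)
    (hS : ∀ θ ∈ Set.Icc (Real.pi / 2) Real.pi, ∀ φ, spherePoint θ φ ∈ U₁) {c : ℤ}
    (hg : ∀ φ : ℝ, ℓ₀ (s₁ (spherePoint (Real.pi / 2) φ)) = Complex.exp (Complex.I * c * φ))
    {w₀ w₁ : (Fin 3 → ℝ) → V} (hw₀ : ∀ x ≠ 0, ContDiffAt ℝ ∞ w₀ x ∧ w₀ x ∈ E x)
    (hw₁ : ∀ x ≠ 0, ContDiffAt ℝ ∞ w₁ x ∧ w₁ x ∈ E x)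
    (hw : ∀ x ≠ 0, ∀ A ∈ E x, ℓ₀ A • w₀ x + ℓ₁ A • w₁ x = A) :
    IsFirstChernNumber E c := by
  have hM : IsOpen ({0}ᶜ : Set (Fin 3 → ℝ)) := isOpen_compl_singleton
  have h0 : U₀ ⊆ {0}ᶜ := hcov ▸ Set.subset_union_left
  have h1 : U₁ ⊆ {0}ᶜ := hcov ▸ Set.subset_union_right
  refine ⟨?_, fun D Ω hΩ => ?_⟩
  · have hR : ∀ (ℓ : V →L[ℂ] ℂ) {w : (Fin 3 → ℝ) → V} {x : Fin 3 → ℝ}, ContDiffAt ℝ ∞ w x →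
        ContDiffAt ℝ ∞ (fun y => ContinuousLinearMap.smulRightL ℂ V V ℓ (w y)) x :=
      fun ℓ w x h =>
        ((ContinuousLinearMap.smulRightL ℂ V V ℓ).restrictScalars ℝ).contDiff.contDiffAt.comp x h
    let D : SmoothConnection {0}ᶜ E := projectedConnection
      (fun x => ContinuousLinearMap.smulRightL ℂ V V ℓ₀ (w₀ x) +
        ContinuousLinearMap.smulRightL ℂ V V ℓ₁ (w₁ x))
      (fun x hx => (hR ℓ₀ (hw₀ x hx).1).add (hR ℓ₁ (hw₁ x hx).1))
      (fun x hx A => (E x).add_mem ((E x).smul_mem _ (hw₀ x hx).2)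
        ((E x).smul_mem _ (hw₁ x hx).2)) hw
    classical
    refine ⟨D, fun x u v => (if x ∈ U₀ then extDeriv₁ (connectionForm D s₀ ℓ₀) x u v else
      extDeriv₁ (connectionForm D s₁ ℓ₁) x u v) • LinearMap.id, ?_⟩
    intro x hx s hs hsx u v
    by_cases hx0 : x ∈ U₀
    · simp [hx0, hU₀.curvature_eq hM h0 D hx0 hsx]
    · have hx1 : x ∈ U₁ := by
        rw [← hcov] at hx
        exact hx.resolve_left hx0
      simp [hx0, hU₁.curvature_eq hM h1 D hx1 hsx]
  · set η₀ := connectionForm D s₀ ℓ₀ with hη₀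
    set η₁ := connectionForm D s₁ ℓ₁ with hη₁
    have hd0 : ∀ x ∈ U₀, ContDiffAt ℝ ∞ η₀ x := fun x hx => hU₀.contDiffAt_connectionForm h0 D hx
    have hd1 : ∀ x ∈ U₁, ContDiffAt ℝ ∞ η₁ x := fun x hx => hU₁.contDiffAt_connectionForm h1 D hx
    let F : ℝ × ℝ → ℂ := fun q => LinearMap.trace ℂ (E (spherePoint q.1 q.2))
      (Ω (spherePoint q.1 q.2) (sphereTheta q.1 q.2) (spherePhi q.1 q.2))
    have hF0 : ∀ q : ℝ × ℝ, spherePoint q.1 q.2 ∈ U₀ → F q =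
        extDeriv₁ η₀ (spherePoint q.1 q.2) (sphereTheta q.1 q.2) (spherePhi q.1 q.2) :=
      fun q hq => hU₀.trace_curvature hM h0 hΩ hq _ _
    have hF1 : ∀ q : ℝ × ℝ, spherePoint q.1 q.2 ∈ U₁ → F q =
        extDeriv₁ η₁ (spherePoint q.1 q.2) (sphereTheta q.1 q.2) (spherePhi q.1 q.2) :=
      fun q hq => hU₁.trace_curvature hM h1 hΩ hq _ _
    have hXc : Continuous fun q : ℝ × ℝ => spherePoint q.1 q.2 := contDiff_spherePoint.continuous
    have hF : Continuous F := by
      rw [continuous_iff_continuousAt]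
      intro q
      have hq : spherePoint q.1 q.2 ∈ U₀ ∪ U₁ := by
        rw [hcov]
        exact spherePoint_ne_zero _ _
      rcases hq with hq | hq
      · refine (continuousAt_extDeriv₁_sphere (hd0 _ hq)).congr ?_
        filter_upwards [hXc.continuousAt.preimage_mem_nhds (hU₀.isOpen.mem_nhds hq)] with z hz
        exact (hF0 z hz).symm
      · refine (continuousAt_extDeriv₁_sphere (hd1 _ hq)).congr ?_
        filter_upwards [hXc.continuousAt.preimage_mem_nhds (hU₁.isOpen.mem_nhds hq)] with z hz
        exact (hF1 z hz).symm
    have hG : Continuous fun θ : ℝ => ∫ φ in (0 : ℝ)..(2 * Real.pi), F (θ, φ) :=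
      intervalIntegral.continuous_parametric_intervalIntegral_of_continuous'
        (f := fun θ φ => F (θ, φ)) hF _ _
    have hpi := Real.pi_pos
    have hN' : ∫ θ in (0 : ℝ)..(Real.pi / 2), ∫ φ in (0 : ℝ)..(2 * Real.pi), F (θ, φ) =
        ∫ φ in (0 : ℝ)..(2 * Real.pi),
          η₀ (spherePoint (Real.pi / 2) φ) (spherePhi (Real.pi / 2) φ) := by
      have := integral_extDeriv₁_sphere hd0 (by positivity) hN
      simp only [spherePhi_zero, map_zero, intervalIntegral.integral_zero, sub_zero] at this
      rw [← this]
      refine intervalIntegral.integral_congr fun θ hθ =>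
        intervalIntegral.integral_congr fun φ _ => ?_
      rw [Set.uIcc_of_le (by positivity)] at hθ
      exact hF0 (θ, φ) (hN θ hθ φ)
    have hS' : ∫ θ in (Real.pi / 2)..Real.pi, ∫ φ in (0 : ℝ)..(2 * Real.pi), F (θ, φ) =
        -∫ φ in (0 : ℝ)..(2 * Real.pi),
          η₁ (spherePoint (Real.pi / 2) φ) (spherePhi (Real.pi / 2) φ) := by
      have := integral_extDeriv₁_sphere hd1 (by linarith) hS
      simp only [spherePhi_pi, map_zero, intervalIntegral.integral_zero, zero_sub] at this
      rw [← this]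
      refine intervalIntegral.integral_congr fun θ hθ =>
        intervalIntegral.integral_congr fun φ _ => ?_
      rw [Set.uIcc_of_le (by linarith)] at hθ
      exact hF1 (θ, φ) (hS θ hθ φ)
    have hmem : Real.pi / 2 ∈ Set.Icc 0 (Real.pi / 2) := ⟨by positivity, le_rfl⟩
    have hmem' : Real.pi / 2 ∈ Set.Icc (Real.pi / 2) Real.pi := ⟨le_rfl, by linarith⟩
    have hint : ∀ {η : (Fin 3 → ℝ) → (Fin 3 → ℝ) →L[ℝ] ℂ} {U : Set (Fin 3 → ℝ)},
        (∀ x ∈ U, ContDiffAt ℝ ∞ η x) → (∀ φ, spherePoint (Real.pi / 2) φ ∈ U) →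
        IntervalIntegrable (fun φ => η (spherePoint (Real.pi / 2) φ) (spherePhi (Real.pi / 2) φ))
          MeasureTheory.volume 0 (2 * Real.pi) := by
      intro η U hη hU
      refine Continuous.intervalIntegrable (continuous_iff_continuousAt.2 fun φ => ?_) _ _
      have h2 : ContinuousAt (fun φ => spherePoint (Real.pi / 2) φ) φ :=
        (hasDerivAt_spherePoint_phi _ φ).continuousAt
      have h3 : ContinuousAt (fun φ => spherePhi (Real.pi / 2) φ) φ :=
        (contDiff_spherePhi.continuous.comp (Continuous.prodMk_right (Real.pi / 2))).continuousAt
      exact (ContinuousAt.comp (f := fun φ => spherePoint (Real.pi / 2) φ)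
        (hη _ (hU φ)).continuousAt h2).clm_apply h3
    rw [sphereIntegral_eq]
    change _ * (∫ θ in (0 : ℝ)..Real.pi, ∫ φ in (0 : ℝ)..(2 * Real.pi), F (θ, φ)) = _
    rw [← intervalIntegral.integral_add_adjacent_intervals (hG.intervalIntegrable 0 (Real.pi / 2))
      (hG.intervalIntegrable (Real.pi / 2) Real.pi), hN', hS', ← sub_eq_add_neg,
      ← intervalIntegral.integral_sub (hint hd0 (hN _ hmem)) (hint hd1 (hS _ hmem'))]
    have hdiff : ∀ φ : ℝ, η₀ (spherePoint (Real.pi / 2) φ) (spherePhi (Real.pi / 2) φ) -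
        η₁ (spherePoint (Real.pi / 2) φ) (spherePhi (Real.pi / 2) φ) = -(Complex.I * c) := by
      intro φ
      rw [← connectionForm_sub_equator hU₀ hU₁ h0 h1 D hg (hN _ hmem φ) (hS _ hmem' φ), neg_sub]
    simp only [hdiff, intervalIntegral.integral_const, sub_zero, Complex.real_smul]
    have : (Real.pi : ℂ) ≠ 0 := by exact_mod_cast Real.pi_ne_zero
    push_cast
    field_simp
    rw [Complex.I_sq]
    ring

end Chern

/-! ### Circularly polarized tensors as eigentensors of the cross product -/

section Algebra

open Complex

/-- The matrix of the cross product `v ↦ x × v`, over `ℂ`. -/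
def crossMatrix (x : Fin 3 → ℝ) : Matrix (Fin 3) (Fin 3) ℂ :=
  !![0, -(x 2 : ℂ), x 1; x 2, 0, -(x 0 : ℂ); -(x 1 : ℂ), x 0, 0]

/-- The Euclidean norm on `ℝ³` (the norm of `Fin 3 → ℝ` is the sup norm). -/
noncomputable def euclideanNorm (x : Fin 3 → ℝ) : ℝ := Real.sqrt (x ⬝ᵥ x)

theorem euclideanNorm_sq (x : Fin 3 → ℝ) :
    euclideanNorm x ^ 2 = x 0 ^ 2 + x 1 ^ 2 + x 2 ^ 2 := by
  have h : x ⬝ᵥ x = x 0 ^ 2 + x 1 ^ 2 + x 2 ^ 2 := by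
    simp [dotProduct, Fin.sum_univ_three]
    ring
  rw [euclideanNorm, Real.sq_sqrt (by rw [h]; positivity), h]

theorem euclideanNorm_sq_ofReal (x : Fin 3 → ℝ) :
    (euclideanNorm x : ℂ) ^ 2 = (x 0 : ℂ) ^ 2 + (x 1 : ℂ) ^ 2 + (x 2 : ℂ) ^ 2 := by
  exact_mod_cast congrArg Complex.ofReal (euclideanNorm_sq x)

theorem euclideanNorm_pos {x : Fin 3 → ℝ} (hx : x ≠ 0) : 0 < euclideanNorm x := by
  apply lt_of_le_of_ne (Real.sqrt_nonneg _)
  intro h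
  apply hx
  have h2 := euclideanNorm_sq x
  rw [euclideanNorm, ← h] at h2
  have h0 : x 0 = 0 := by nlinarith [sq_nonneg (x 0), sq_nonneg (x 1), sq_nonneg (x 2)]
  have h1 : x 1 = 0 := by nlinarith [sq_nonneg (x 0), sq_nonneg (x 1), sq_nonneg (x 2)]
  have h3 : x 2 = 0 := by nlinarith [sq_nonneg (x 0), sq_nonneg (x 1), sq_nonneg (x 2)]
  ext i
  fin_cases i <;> assumption

theorem crossMatrix_transpose (x : Fin 3 → ℝ) : (crossMatrix x)ᵀ = -crossMatrix x := by
  ext i j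
  fin_cases i <;> fin_cases j <;> simp [crossMatrix]

theorem crossMatrix_mulVec (x : Fin 3 → ℝ) (v : Fin 3 → ℂ) :
    crossMatrix x *ᵥ v =
      ![x 1 * v 2 - x 2 * v 1, x 2 * v 0 - x 0 * v 2, x 0 * v 1 - x 1 * v 0] := by
  ext i
  fin_cases i <;> simp [crossMatrix, Matrix.mulVec, dotProduct, Fin.sum_univ_three] <;> ring

theorem crossMatrix_mul_apply (x : Fin 3 → ℝ) (A : Matrix (Fin 3) (Fin 3) ℂ) (i j : Fin 3) :
    (crossMatrix x * A) i j = (![x 1 * A 2 j - x 2 * A 1 j, x 2 * A 0 j - x 0 * A 2 j,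
      x 0 * A 1 j - x 1 * A 0 j] : Fin 3 → ℂ) i :=
  congrFun (crossMatrix_mulVec x fun k => A k j) i

theorem crossMatrix_smul (c : ℝ) (x : Fin 3 → ℝ) :
    crossMatrix (c • x) = (c : ℂ) • crossMatrix x := by
  ext i j
  fin_cases i <;> fin_cases j <;> simp [crossMatrix]

theorem crossMatrix_mulVec_self (x : Fin 3 → ℝ) :
    crossMatrix x *ᵥ (fun i => (x i : ℂ)) = 0 := by
  ext i
  fin_cases i <;> simp [crossMatrix, Matrix.mulVec, dotProduct, Fin.sum_univ_three] <;> ring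

theorem crossMatrix_mul_self (x : Fin 3 → ℝ) : crossMatrix x * crossMatrix x =
    Matrix.vecMulVec (fun i => (x i : ℂ)) (fun i => (x i : ℂ)) - (euclideanNorm x : ℂ) ^ 2 • 1 := by
  rw [euclideanNorm_sq_ofReal]
  ext i j
  fin_cases i <;> fin_cases j <;>
    simp [crossMatrix, Matrix.mul_apply, Fin.sum_univ_three, Matrix.vecMulVec] <;> ring

/-- On symmetric traceless tensors annihilating `x`, the product with the cross product matrix is
again symmetric. -/
theorem transpose_crossMatrix_mul {x : Fin 3 → ℝ} {A : Matrix (Fin 3) (Fin 3) ℂ} (hA : Aᵀ = A)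
    (htr : A.trace = 0) (hx : A *ᵥ (fun i => (x i : ℂ)) = 0) :
    (crossMatrix x * A)ᵀ = crossMatrix x * A := by
  have hs : ∀ i j, A j i = A i j := fun i j => congrFun (congrFun hA i) j
  have hk : ∀ i, A i 0 * x 0 + A i 1 * x 1 + A i 2 * x 2 = 0 := fun i => by
    have := congrFun hx i
    simpa [Matrix.mulVec, dotProduct, Fin.sum_univ_three] using this
  have ht : A 0 0 + A 1 1 + A 2 2 = 0 := by
    simpa [Matrix.trace, Fin.sum_univ_three] using htr
  have h0 := hk 0
  have h1 := hk 1
  have h2 := hk 2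
  have s1 := hs 0 1
  have s2 := hs 0 2
  have s3 := hs 1 2
  ext i j
  fin_cases i <;> fin_cases j <;>
    simp [crossMatrix_mul_apply, -Matrix.transpose_mul] <;> grind

theorem exp_neg_I_mul {ε : ℝ} (hε : ε ^ 2 = 1) (t : ℝ) :
    cexp (-(I * ε * t)) = Real.cos t - I * ε * Real.sin t := by
  rw [show -(I * ε * t) = ((-(ε * t) : ℝ) : ℂ) * I by push_cast; ring, exp_mul_I, ← ofReal_cos,
    ← ofReal_sin, Real.cos_neg, Real.sin_neg]
  rcases sq_eq_one_iff.1 hε with rfl | rfl <;> simp <;> ring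

/-- Rodrigues' formula in terms of the cross product with the unit vector `k / |k|`. -/
theorem axisRotation_map {k : Fin 3 → ℝ} (ψ : ℝ) :
    (axisRotation k ψ).map Complex.ofReal =
      (Real.cos ψ : ℂ) • (1 : Matrix (Fin 3) (Fin 3) ℂ) +
      (Real.sin ψ : ℂ) • crossMatrix ((euclideanNorm k)⁻¹ • k) +
      (1 - Real.cos ψ : ℂ) • Matrix.vecMulVec
        (fun i => (((euclideanNorm k)⁻¹ • k) i : ℂ))
        (fun i => (((euclideanNorm k)⁻¹ • k) i : ℂ)) := by
  ext i j
  fin_cases i <;> fin_cases j <;>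
    simp [axisRotation, crossMatrix, euclideanNorm, Matrix.vecMulVec]

/-- Gravitons of helicity `2ε`, `ε = ±1`, are the symmetric tensors `A` with `k × A = -iε|k| A`. -/
theorem mem_helicityGraviton_iff {h : ℤ} {ε : ℝ} (hε : ε ^ 2 = 1) (hh : (h : ℝ) = 2 * ε)
    {k : Fin 4 → ℝ} (hk : spatialPart k ≠ 0) (A : Matrix (Fin 3) (Fin 3) ℂ) :
    A ∈ helicityGraviton h k ↔ Aᵀ = A ∧ crossMatrix (spatialPart k) * A =
      (-(I * ε * euclideanNorm (spatialPart k))) • A := by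
  set x := spatialPart k with hx
  have hr := euclideanNorm_pos hk
  have hrC : (euclideanNorm x : ℂ) ≠ 0 := by exact_mod_cast hr.ne'
  set n : Fin 3 → ℝ := (euclideanNorm x)⁻¹ • x with hn
  have hnx : ∀ i, (n i : ℂ) = (euclideanNorm x : ℂ)⁻¹ * x i := fun i => by simp [hn]
  have hεC : (ε : ℂ) ^ 2 = 1 := by exact_mod_cast hε
  have hhC : (h : ℂ) = 2 * ε := by exact_mod_cast congrArg Complex.ofReal hh
  set J := crossMatrix n with hJ
  set N := Matrix.vecMulVec (fun i => (n i : ℂ)) (fun i => (n i : ℂ)) with hN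
  have hJx : J = (euclideanNorm x : ℂ)⁻¹ • crossMatrix x := by
    rw [hJ, hn, crossMatrix_smul]; push_cast; rfl
  have hnn : (euclideanNorm n : ℂ) ^ 2 = 1 := by
    rw [euclideanNorm_sq_ofReal, hnx, hnx, hnx]
    field_simp
    exact (euclideanNorm_sq_ofReal x).symm
  have hJJ : J * J = N - 1 := by
    rw [hJ, crossMatrix_mul_self, hnn, one_smul]
  have hJT : Jᵀ = -J := crossMatrix_transpose n
  have hNT : Nᵀ = N := by simp [hN, Matrix.transpose_vecMulVec]
  have hcond : crossMatrix x * A = (-(I * ε * euclideanNorm x)) • A ↔ J * A = (-(I * ε)) • A := by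
    rw [hJx, Matrix.smul_mul, inv_smul_eq_iff₀ hrC, smul_smul]
    ring_nf
  have hAN : A *ᵥ (fun i => (x i : ℂ)) = 0 → A * N = 0 := by
    intro h0
    have h1 : A *ᵥ (fun i => (n i : ℂ)) = 0 := by
      have : (fun i => (n i : ℂ)) = (euclideanNorm x : ℂ)⁻¹ • fun i => (x i : ℂ) := by
        ext i; simp [hnx]
      rw [this, Matrix.mulVec_smul, h0, smul_zero]
    rw [hN, Matrix.mul_vecMulVec, h1, Matrix.zero_vecMulVec]
  have hNA : Aᵀ = A → A * N = 0 → N * A = 0 := by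
    intro h0 h1
    rw [← Matrix.transpose_inj, Matrix.transpose_mul, h0, hNT, h1, Matrix.transpose_zero]
  rw [hcond]
  constructor
  · rintro ⟨⟨hsym, htr, hker⟩, hrot⟩
    have h1 := hAN hker
    have h2 := hNA hsym h1
    have hR : ∀ ψ : ℝ, cexp (-(I * ε * (2 * ψ : ℝ))) • A =
        (Real.cos ψ : ℂ) ^ 2 • A + (Real.cos ψ * Real.sin ψ : ℂ) • (J * A - A * J)
          - (Real.sin ψ : ℂ) ^ 2 • (J * A * J) := by
      intro ψ
      have := hrot ψ
      rw [rotateTensor, axisRotation_map, ← hx, ← hn, ← hJ, ← hN, hhC] at this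
      rw [show -(I * ε * (2 * ψ : ℝ)) = -(I * (2 * ε) * ψ) by push_cast; ring, ← this]
      simp only [Matrix.add_mul, Matrix.mul_add, Matrix.transpose_add, Matrix.transpose_smul,
        Matrix.transpose_one, hJT, hNT, Matrix.smul_mul, Matrix.mul_smul, Matrix.one_mul,
        Matrix.mul_one, h1, h2, Matrix.mul_neg, Matrix.mul_assoc, Matrix.mul_zero,
        Matrix.zero_mul, smul_zero]
      module
    have e1 := hR (Real.pi / 2)
    have e2 := hR (Real.pi / 4)
    rw [exp_neg_I_mul hε, mul_div_cancel₀ _ two_ne_zero] at e1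
    rw [exp_neg_I_mul hε, show 2 * (Real.pi / 4) = Real.pi / 2 by ring] at e2
    simp at e1 e2
    -- The half turn gives `J A J = A`, hence `A J = -J A`; the quarter turn of `A` then is `J A`.
    have e3 : A * J = -(J * A) := by
      have e4 : J * A = J * J * A * J := by
        rw [Matrix.mul_assoc, Matrix.mul_assoc, ← Matrix.mul_assoc J A J]
        rw [← e1]
      rw [e4, hJJ, Matrix.sub_mul, h2, Matrix.one_mul, zero_sub, Matrix.neg_mul, neg_neg]
    have e5 : ((√2 / 2 : ℝ) : ℂ) ^ 2 = 1 / 2 := by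
      rw [← ofReal_pow, div_pow, Real.sq_sqrt (by norm_num)]
      norm_num
    push_cast at e5
    rw [e3, ← e1, e5, ← sq, e5] at e2
    refine ⟨hsym, ?_⟩
    rw [neg_smul, e2]
    module
  · rintro ⟨hsym, hJA⟩
    have hAJ : A * J = (I * ε) • A := by
      rw [← Matrix.transpose_inj, Matrix.transpose_mul, hsym, hJT, Matrix.neg_mul, hJA,
        Matrix.transpose_smul, hsym, neg_smul, neg_neg]
    have hI : (I * ε) * (I * ε) = -1 := by
      linear_combination I ^ 2 * hεC + I_sq
    have hA : A = (I * ε) • (J * A) := by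
      rw [hJA, smul_smul, mul_neg, hI, neg_neg, one_smul]
    have htr : A.trace = 0 := by
      have h1 : (J * A).trace = -(J * A).trace := by
        conv_lhs => rw [← Matrix.trace_transpose, Matrix.transpose_mul, hsym, hJT, Matrix.mul_neg,
          Matrix.trace_neg, Matrix.trace_mul_comm]
      rw [hA, Matrix.trace_smul, self_eq_neg.1 h1, smul_zero]
    have hker : A *ᵥ (fun i => (x i : ℂ)) = 0 := by
      have h1 : A * J * J = -A := by
        rw [hAJ, Matrix.smul_mul, hAJ, smul_smul, hI, neg_one_smul]
      have h2 : J *ᵥ (fun i => (x i : ℂ)) = 0 := by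
        rw [hJx, Matrix.smul_mulVec, crossMatrix_mulVec_self, smul_zero]
      rw [← neg_eq_zero, ← Matrix.neg_mulVec, ← h1, ← Matrix.mulVec_mulVec, h2, Matrix.mulVec_zero]
    have h2 := hNA hsym (hAN hker)
    refine ⟨⟨hsym, htr, hker⟩, fun ψ => ?_⟩
    have hRA : (axisRotation x ψ).map Complex.ofReal * A = cexp (-(I * ε * ψ)) • A := by
      rw [axisRotation_map, ← hn, ← hJ, ← hN, Matrix.add_mul, Matrix.add_mul, Matrix.smul_mul,
        Matrix.smul_mul, Matrix.smul_mul, h2, hJA, exp_neg_I_mul hε, Matrix.one_mul]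
      module
    rw [rotateTensor, ← hx, hRA, ← Matrix.transpose_inj, Matrix.transpose_mul,
      Matrix.transpose_transpose, Matrix.transpose_smul, Matrix.transpose_smul, hsym,
      Matrix.mul_smul, hRA, smul_smul, ← Complex.exp_add, hhC]
    ring_nf

end Algebra

/-! ### Explicit circularly polarized tensors -/

section Polarization

open Complex

/-- The tensors of helicity `2ε` at `x`, described algebraically. -/
def IsCircularTensor (ε : ℝ) (x : Fin 3 → ℝ) (A : Matrix (Fin 3) (Fin 3) ℂ) : Prop :=
  Aᵀ = A ∧ crossMatrix x * A = (-(I * ε * euclideanNorm x)) • A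

/-- The circularly polarized vectors at `x`: `x × m = -iε|x| m`. -/
def IsCircularVector (ε : ℝ) (x : Fin 3 → ℝ) (m : Fin 3 → ℂ) : Prop :=
  crossMatrix x *ᵥ m = (-(I * ε * euclideanNorm x)) • m

theorem IsCircularVector.isCircularTensor {ε : ℝ} {x : Fin 3 → ℝ} {m : Fin 3 → ℂ}
    (hm : IsCircularVector ε x m) : IsCircularTensor ε x (Matrix.vecMulVec m m) :=
  ⟨Matrix.transpose_vecMulVec m m, by
    rw [Matrix.mul_vecMulVec, show crossMatrix x *ᵥ m = _ from hm, Matrix.smul_vecMulVec]⟩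

theorem IsCircularTensor.isCircularVector {ε : ℝ} {x : Fin 3 → ℝ} {A : Matrix (Fin 3) (Fin 3) ℂ}
    (hA : IsCircularTensor ε x A) (j : Fin 3) : IsCircularVector ε x (fun i => A i j) := by
  ext i
  exact congrFun (congrFun hA.2 i) j

/-- The circularly polarized vectors at `x` form a line. -/
theorem IsCircularVector.mul_comm {ε : ℝ} (hε : ε ^ 2 = 1) {x : Fin 3 → ℝ} (hx : x ≠ 0)
    {v m : Fin 3 → ℂ} (hv : IsCircularVector ε x v) (hm : IsCircularVector ε x m) (i j : Fin 3) :
    v i * m j = v j * m i := by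
  have hr : (euclideanNorm x : ℂ) ≠ 0 := by exact_mod_cast (euclideanNorm_pos hx).ne'
  have hεC : (ε : ℂ) ^ 2 = 1 := by exact_mod_cast hε
  have hε0 : (ε : ℂ) ≠ 0 := by
    intro h
    simp [h] at hεC
  have hr2 := euclideanNorm_sq_ofReal x
  set c : ℂ := -(I * ε * euclideanNorm x) with hc
  have hc0 : c ≠ 0 := neg_ne_zero.2 (mul_ne_zero (mul_ne_zero I_ne_zero hε0) hr)
  rw [IsCircularVector, crossMatrix_mulVec, ← hc] at hv hm
  have v0 : (x 1 * v 2 - x 2 * v 1 : ℂ) = c * v 0 := congrFun hv 0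
  have v1 : (x 2 * v 0 - x 0 * v 2 : ℂ) = c * v 1 := congrFun hv 1
  have v2 : (x 0 * v 1 - x 1 * v 0 : ℂ) = c * v 2 := congrFun hv 2
  have m0 : (x 1 * m 2 - x 2 * m 1 : ℂ) = c * m 0 := congrFun hm 0
  have m1 : (x 2 * m 0 - x 0 * m 2 : ℂ) = c * m 1 := congrFun hm 1
  have m2 : (x 0 * m 1 - x 1 * m 0 : ℂ) = c * m 2 := congrFun hm 2
  have xv : (x 0 * v 0 + x 1 * v 1 + x 2 * v 2 : ℂ) = 0 :=
    mul_left_cancel₀ hc0 (by linear_combination -(x 0 : ℂ) * v0 - x 1 * v1 - x 2 * v2)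
  have xm : (x 0 * m 0 + x 1 * m 1 + x 2 * m 2 : ℂ) = 0 :=
    mul_left_cancel₀ hc0 (by linear_combination -(x 0 : ℂ) * m0 - x 1 * m1 - x 2 * m2)
  -- The triple product `x · (v × m)` is both `c (v · m)` and `-c (v · m)`.
  have xw : (x 0 * (v 1 * m 2 - v 2 * m 1) + x 1 * (v 2 * m 0 - v 0 * m 2)
      + x 2 * (v 0 * m 1 - v 1 * m 0) : ℂ) = 0 := by
    linear_combination (m 0 * v0 + m 1 * v1 + m 2 * v2 - v 0 * m0 - v 1 * m1 - v 2 * m2) / 2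
  have hr2' : (euclideanNorm x : ℂ) ^ 2 ≠ 0 := pow_ne_zero 2 hr
  have w0 : v 1 * m 2 - v 2 * m 1 = 0 := mul_left_cancel₀ hr2' (by
    rw [hr2]
    linear_combination (x 0 : ℂ) * xw - (x 1 * v 2 - x 2 * v 1) * xm + (x 1 * m 2 - x 2 * m 1) * xv)
  have w1 : v 2 * m 0 - v 0 * m 2 = 0 := mul_left_cancel₀ hr2' (by
    rw [hr2]
    linear_combination (x 1 : ℂ) * xw - (x 2 * v 0 - x 0 * v 2) * xm + (x 2 * m 0 - x 0 * m 2) * xv)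
  have w2 : v 0 * m 1 - v 1 * m 0 = 0 := mul_left_cancel₀ hr2' (by
    rw [hr2]
    linear_combination (x 2 : ℂ) * xw - (x 0 * v 1 - x 1 * v 0) * xm + (x 0 * m 1 - x 1 * m 0) * xv)
  fin_cases i <;> fin_cases j <;> simp <;> grind

/-- The quadratic form of a tensor at the vector `e`. -/
def quadForm (e : Fin 3 → ℂ) (A : Matrix (Fin 3) (Fin 3) ℂ) : ℂ := e ⬝ᵥ A *ᵥ e

theorem quadForm_smul (e : Fin 3 → ℂ) (c : ℂ) (A : Matrix (Fin 3) (Fin 3) ℂ) :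
    quadForm e (c • A) = c * quadForm e A := by
  rw [quadForm, Matrix.smul_mulVec, dotProduct_smul]
  rfl

theorem continuous_quadForm :
    Continuous fun p : (Fin 3 → ℂ) × Matrix (Fin 3) (Fin 3) ℂ => quadForm p.1 p.2 := by
  unfold quadForm
  fun_prop

/-- The continuous dual of a normed space, with the topology of the norm. (For matrices, type class
inference would find the entrywise topology, which agrees with it only after unfolding.) -/
abbrev NormedDual (V : Type*) [NormedAddCommGroup V] [NormedSpace ℂ V] := V →L[ℂ] ℂ

/-- The quadratic form of a tensor at the vector `e`, as a functional of the tensor. -/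
noncomputable def quadFormL (e : Fin 3 → ℂ) : NormedDual (Matrix (Fin 3) (Fin 3) ℂ) :=
  ⟨{ toFun := quadForm e
     map_add' := fun A B => by
      change e ⬝ᵥ (A + B) *ᵥ e = e ⬝ᵥ A *ᵥ e + e ⬝ᵥ B *ᵥ e
      rw [Matrix.add_mulVec, dotProduct_add]
     map_smul' := fun c A => quadForm_smul e c A },
    continuous_quadForm.comp (Continuous.prodMk_right e)⟩

theorem quadForm_vecMulVec (e m : Fin 3 → ℂ) :
    quadForm e (Matrix.vecMulVec m m) = (e ⬝ᵥ m) ^ 2 := by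
  rw [quadForm, Matrix.vecMulVec_mulVec, dotProduct_smul, sq]
  simp [dotProduct_comm]

/-- The circularly polarized tensors at `x` form a line, spanned by the square of any circularly
polarized vector `m ≠ 0`. -/
theorem IsCircularTensor.smul_eq {ε : ℝ} (hε : ε ^ 2 = 1) {x : Fin 3 → ℝ} (hx : x ≠ 0)
    {A : Matrix (Fin 3) (Fin 3) ℂ} (hA : IsCircularTensor ε x A) {m : Fin 3 → ℂ}
    (hm : IsCircularVector ε x m) (e : Fin 3 → ℂ) :
    (e ⬝ᵥ m) ^ 2 • A = quadForm e A • Matrix.vecMulVec m m := by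
  have h1 : ∀ i j k, A i j * m k = A k j * m i := fun i j k =>
    (hA.isCircularVector j).mul_comm hε hx hm i k
  have hs : ∀ i j, A j i = A i j := fun i j => congrFun (congrFun hA.1 i) j
  have h2 : ∀ i j k l, m k * m l * A i j = A k l * (m i * m j) := fun i j k l => by
    linear_combination m l * h1 i j k + m i * m l * hs j k + m i * h1 j k l - m i * m j * hs l k
  ext i j
  simp only [Matrix.smul_apply, Matrix.vecMulVec_apply, smul_eq_mul, quadForm, dotProduct,
    Matrix.mulVec, Fin.sum_univ_three]
  linear_combination e 0 * e 0 * h2 i j 0 0 + e 0 * e 1 * h2 i j 0 1 + e 0 * e 2 * h2 i j 0 2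
    + e 1 * e 0 * h2 i j 1 0 + e 1 * e 1 * h2 i j 1 1 + e 1 * e 2 * h2 i j 1 2
    + e 2 * e 0 * h2 i j 2 0 + e 2 * e 1 * h2 i j 2 1 + e 2 * e 2 * h2 i j 2 2

/-- `|x| + δ x₃`; for `δ = 1` (resp. `δ = -1`) it vanishes exactly on the closed negative (resp.
positive) third half-axis. -/
noncomputable def height (δ : ℝ) (x : Fin 3 → ℝ) : ℝ := euclideanNorm x + δ * x 2

/-- The complex coordinate `x₁ + iσx₂` of the projection to the plane. -/
noncomputable def planar (σ : ℝ) (x : Fin 3 → ℝ) : ℂ := x 0 + I * σ * x 1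

/-- A circularly polarized vector at `x`, quadratic in the coordinates of `x` and `|x|`, that
vanishes exactly where `height δ x` does. In terms of a spinor `(z, w)` of `x` it is `z̄²`, for
`δ = 1`, or `w̄²`, for `δ = -1`, times the square `(z² - w², i(z² + w²), -2zw)` of the spinor
(for `ε = 1`; up to a constant). -/
noncomputable def polVector (ε δ : ℝ) (x : Fin 3 → ℝ) : Fin 3 → ℂ :=
  ![(height δ x) ^ 2 - planar (ε * δ) x ^ 2,
    I * (ε * δ) * ((height δ x) ^ 2 + planar (ε * δ) x ^ 2),
    -2 * δ * height δ x * planar (ε * δ) x]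

/-- The circularly polarized tensor that is the square of `polVector`. -/
noncomputable def polTensor (ε δ : ℝ) (x : Fin 3 → ℝ) : Matrix (Fin 3) (Fin 3) ℂ :=
  Matrix.vecMulVec (polVector ε δ x) (polVector ε δ x)

/-- A constant vector whose dot product with `polVector ε δ` is `2 (height δ) ^ 2`. -/
def refVector (ε δ : ℝ) : Fin 3 → ℂ := ![1, -(I * (ε * δ)), 0]

variable {ε δ : ℝ}

theorem isCircularVector_polVector (hε : ε ^ 2 = 1) (hδ : δ ^ 2 = 1) (x : Fin 3 → ℝ) :
    IsCircularVector ε x (polVector ε δ x) := by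
  have hr2 := euclideanNorm_sq_ofReal x
  have hεC : (ε : ℂ) ^ 2 = 1 := by exact_mod_cast hε
  have hδC : (δ : ℂ) ^ 2 = 1 := by exact_mod_cast hδ
  have hI := I_sq
  rw [IsCircularVector, crossMatrix_mulVec]
  ext i
  fin_cases i <;> simp [polVector, height, planar]
  · grind
  · grind
  · grind

theorem isCircularTensor_polTensor (hε : ε ^ 2 = 1) (hδ : δ ^ 2 = 1) (x : Fin 3 → ℝ) :
    IsCircularTensor ε x (polTensor ε δ x) :=
  (isCircularVector_polVector hε hδ x).isCircularTensor

theorem refVector_dotProduct (hε : ε ^ 2 = 1) (hδ : δ ^ 2 = 1) (x : Fin 3 → ℝ) :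
    refVector ε δ ⬝ᵥ polVector ε δ x = 2 * (height δ x) ^ 2 := by
  have hεC : (ε : ℂ) ^ 2 = 1 := by exact_mod_cast hε
  have hδC : (δ : ℂ) ^ 2 = 1 := by exact_mod_cast hδ
  have hI := I_sq
  simp [refVector, polVector, dotProduct, Fin.sum_univ_three]
  grind

theorem height_neg_mul (hδ : δ ^ 2 = 1) (hε : ε ^ 2 = 1) (x : Fin 3 → ℝ) :
    (height δ x * height (-δ) x : ℂ) = planar ε x * planar (-ε) x := by
  have hr2 := euclideanNorm_sq_ofReal x
  have hεC : (ε : ℂ) ^ 2 = 1 := by exact_mod_cast hε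
  have hδC : (δ : ℂ) ^ 2 = 1 := by exact_mod_cast hδ
  have hI := I_sq
  simp [height, planar]
  grind

/-- The transition from the frame `polTensor ε δ` to the frame `polTensor ε (-δ)`. -/
theorem polVector_neg (hε : ε ^ 2 = 1) (hδ : δ ^ 2 = 1) (x : Fin 3 → ℝ) :
    (height δ x : ℂ) ^ 2 • polVector ε (-δ) x =
      -(planar (-(ε * δ)) x ^ 2 • polVector ε δ x) := by
  have h := height_neg_mul hδ (ε := ε * δ) (by rw [mul_pow, hε, hδ, one_mul]) x
  have hδC : (δ : ℂ) ^ 2 = 1 := by exact_mod_cast hδ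
  ext i
  fin_cases i <;> simp [polVector] <;> grind

theorem polTensor_neg (hε : ε ^ 2 = 1) (hδ : δ ^ 2 = 1) (x : Fin 3 → ℝ) :
    (height δ x : ℂ) ^ 4 • polTensor ε (-δ) x = planar (-(ε * δ)) x ^ 4 • polTensor ε δ x := by
  have h := polVector_neg hε hδ x
  have h1 : ∀ (c : ℂ) (v : Fin 3 → ℂ),
      Matrix.vecMulVec (c • v) (c • v) = c ^ 2 • Matrix.vecMulVec v v := by
    intro c v
    rw [Matrix.smul_vecMulVec, Matrix.vecMulVec_smul, smul_smul, sq]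
  rw [← neg_smul] at h
  have := congrArg (fun v : Fin 3 → ℂ => Matrix.vecMulVec v v) h
  simp only [h1] at this
  rw [polTensor, polTensor]
  convert this using 2 <;> ring

theorem polVector_dotProduct_neg (hε : ε ^ 2 = 1) (hδ : δ ^ 2 = 1) (x : Fin 3 → ℝ) :
    polVector ε δ x ⬝ᵥ polVector (-ε) δ x = 8 * (euclideanNorm x) ^ 2 * (height δ x) ^ 2 := by
  have hr2 := euclideanNorm_sq_ofReal x
  have hεC : (ε : ℂ) ^ 2 = 1 := by exact_mod_cast hε
  have hδC : (δ : ℂ) ^ 2 = 1 := by exact_mod_cast hδ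
  have hI := I_sq
  simp [polVector, dotProduct, Fin.sum_univ_three, planar, height]
  grind

theorem polVector_dotProduct_neg_neg (hε : ε ^ 2 = 1) (hδ : δ ^ 2 = 1) (x : Fin 3 → ℝ) :
    polVector ε δ x ⬝ᵥ polVector (-ε) (-δ) x =
      -(8 * (euclideanNorm x) ^ 2 * planar (ε * δ) x ^ 2) := by
  have hr2 := euclideanNorm_sq_ofReal x
  have hεC : (ε : ℂ) ^ 2 = 1 := by exact_mod_cast hε
  have hδC : (δ : ℂ) ^ 2 = 1 := by exact_mod_cast hδ
  have hI := I_sq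
  simp [polVector, dotProduct, Fin.sum_univ_three, planar, height]
  grind

theorem polVector_dotProduct_self (hε : ε ^ 2 = 1) (hδ : δ ^ 2 = 1) (x : Fin 3 → ℝ) :
    polVector ε δ x ⬝ᵥ polVector ε δ x = 0 := by
  have hεC : (ε : ℂ) ^ 2 = 1 := by exact_mod_cast hε
  have hδC : (δ : ℂ) ^ 2 = 1 := by exact_mod_cast hδ
  have hI := I_sq
  simp [polVector, dotProduct, Fin.sum_univ_three]
  grind

theorem polVector_dotProduct_self_neg (hε : ε ^ 2 = 1) (hδ : δ ^ 2 = 1) (x : Fin 3 → ℝ) :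
    polVector ε δ x ⬝ᵥ polVector ε (-δ) x = 0 := by
  have h := height_neg_mul hδ (ε := ε * δ) (by rw [mul_pow, hε, hδ, one_mul]) x
  have hεC : (ε : ℂ) ^ 2 = 1 := by exact_mod_cast hε
  have hδC : (δ : ℂ) ^ 2 = 1 := by exact_mod_cast hδ
  have hI := I_sq
  simp [polVector, dotProduct, Fin.sum_univ_three]
  grind

end Polarization

/-! ### Smooth frames of the polarized bundles -/

section Frames

open Complex

variable {ε δ : ℝ}

theorem contDiffAt_euclideanNorm {x : Fin 3 → ℝ} (hx : x ≠ 0) :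
    ContDiffAt ℝ ∞ euclideanNorm x := by
  have h : (x ⬝ᵥ x) ≠ 0 := by
    have := euclideanNorm_pos hx
    rw [euclideanNorm, Real.sqrt_pos] at this
    exact this.ne'
  refine ContDiffAt.sqrt ?_ h
  simp only [dotProduct, Fin.sum_univ_three]
  fun_prop

theorem contDiffAt_height {x : Fin 3 → ℝ} (hx : x ≠ 0) (δ : ℝ) :
    ContDiffAt ℝ ∞ (fun x => (height δ x : ℂ)) x := by
  refine ofRealCLM.contDiff.contDiffAt.comp x ?_
  have h := contDiffAt_euclideanNorm hx
  change ContDiffAt ℝ ∞ (fun x => euclideanNorm x + δ * x 2) x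
  fun_prop

theorem contDiff_planar (σ : ℝ) : ContDiff ℝ ∞ (planar σ) := by
  unfold planar
  have h : ∀ i, ContDiff ℝ ∞ (fun x : Fin 3 → ℝ => (x i : ℂ)) := fun i =>
    ofRealCLM.contDiff.comp (contDiff_apply ℝ ℝ i)
  have h0 := h 0
  have h1 := h 1
  fun_prop

theorem contDiffAt_polVector {x : Fin 3 → ℝ} (hx : x ≠ 0) (ε δ : ℝ) (i : Fin 3) :
    ContDiffAt ℝ ∞ (fun x => polVector ε δ x i) x := by
  have h1 := contDiffAt_height hx δ
  have h2 := (contDiff_planar (ε * δ)).contDiffAt (x := x)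
  fin_cases i <;> simp only [polVector] <;> simp <;> fun_prop

/-- Smoothness of matrix-valued maps may be checked on the entries. The real structure on matrices
is stated explicitly: it is the restriction of the complex one. -/
theorem contDiffAt_matrix {X : Type*} [NormedAddCommGroup X] [NormedSpace ℝ X]
    {f : X → Matrix (Fin 3) (Fin 3) ℂ} {x : X} (h : ∀ i j, ContDiffAt ℝ ∞ (fun y => f y i j) x) :
    @ContDiffAt ℝ _ X _ _ (Matrix (Fin 3) (Fin 3) ℂ) _ NormedSpace.complexToReal ∞ f x := 
  contDiffAt_pi.2 fun i => contDiffAt_pi.2 fun j => h i j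

theorem contDiffAt_smul_polTensor {x : Fin 3 → ℝ} (hx : x ≠ 0) {f : (Fin 3 → ℝ) → ℂ}
    (hf : ContDiffAt ℝ ∞ f x) (ε δ : ℝ) :
    @ContDiffAt ℝ _ _ _ _ (Matrix (Fin 3) (Fin 3) ℂ) _ NormedSpace.complexToReal ∞
      (fun x => f x • polTensor ε δ x) x :=
  contDiffAt_matrix fun i j =>
    hf.mul ((contDiffAt_polVector hx ε δ i).mul (contDiffAt_polVector hx ε δ j))

theorem height_zero_right (δ : ℝ) : height δ 0 = 0 := by
  simp [height, euclideanNorm]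

theorem ne_zero_of_height_ne_zero {x : Fin 3 → ℝ} (h : height δ x ≠ 0) : x ≠ 0 := by
  rintro rfl
  exact h (height_zero_right δ)

theorem height_pow_add_pos {x : Fin 3 → ℝ} (hx : x ≠ 0) :
    0 < height 1 x ^ 4 + height (-1) x ^ 4 := by
  by_cases h : height 1 x = 0
  · have h2 : height (-1) x = 2 * euclideanNorm x := by
      rw [height] at h ⊢
      linarith
    have := euclideanNorm_pos hx
    rw [h, h2]
    positivity
  · positivity

theorem isOpen_height_ne_zero (δ : ℝ) : IsOpen {x : Fin 3 → ℝ | height δ x ≠ 0} := by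
  have h : Continuous (height δ) := by
    unfold height euclideanNorm dotProduct
    fun_prop
  exact isOpen_ne_fun h continuous_const

theorem IsCircularTensor.height_smul_eq (hε : ε ^ 2 = 1) (hδ : δ ^ 2 = 1) {x : Fin 3 → ℝ}
    (hx : x ≠ 0) {A : Matrix (Fin 3) (Fin 3) ℂ} (hA : IsCircularTensor ε x A) :
    (4 * height δ x ^ 4 : ℂ) • A = quadForm (refVector ε δ) A • polTensor ε δ x := by
  have h := hA.smul_eq hε hx (isCircularVector_polVector hε hδ x) (refVector ε δ)
  rw [refVector_dotProduct hε hδ] at h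
  rw [polTensor, ← h]
  congr 1
  ring

theorem quadForm_polTensor (hε : ε ^ 2 = 1) (hδ : δ ^ 2 = 1) (x : Fin 3 → ℝ) :
    quadForm (refVector ε δ) (polTensor ε δ x) = 4 * height δ x ^ 4 := by
  rw [polTensor, quadForm_vecMulVec, refVector_dotProduct hε hδ]
  ring

/-- The frame of the tensors of helicity `2ε` with coordinate functional
`quadFormL (refVector ε δ)`. -/
noncomputable def polFrame (ε δ : ℝ) (x : Fin 3 → ℝ) : Matrix (Fin 3) (Fin 3) ℂ :=
  (4 * height δ x ^ 4 : ℂ)⁻¹ • polTensor ε δ x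

variable {E : (Fin 3 → ℝ) → Submodule ℂ (Matrix (Fin 3) (Fin 3) ℂ)}

theorem isLineFrame_polFrame (hε : ε ^ 2 = 1) (hδ : δ ^ 2 = 1)
    (hE : ∀ x ≠ 0, ∀ A, A ∈ E x ↔ IsCircularTensor ε x A) :
    IsLineFrame E {x | height δ x ≠ 0} (polFrame ε δ) (quadFormL (refVector ε δ)) where
  isOpen := isOpen_height_ne_zero δ
  contDiffOn x hx := (contDiffAt_smul_polTensor (ne_zero_of_height_ne_zero hx)
    ((contDiffAt_const.mul ((contDiffAt_height (ne_zero_of_height_ne_zero hx) δ).pow 4)).inv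
      (by simpa using hx)) ε δ).contDiffWithinAt
  mem x hx := (E x).smul_mem _
    ((hE x (ne_zero_of_height_ne_zero hx) _).2 (isCircularTensor_polTensor hε hδ x))
  coord x hx := by
    change quadForm _ _ = 1
    rw [polFrame, quadForm_smul, quadForm_polTensor hε hδ]
    exact inv_mul_cancel₀ (by simpa using hx)
  eq_smul x hx A hA := by
    have hx0 := ne_zero_of_height_ne_zero hx
    have h1 : (4 * height δ x ^ 4 : ℂ) ≠ 0 := by simpa using hx
    change A = quadForm _ A • polFrame ε δ x
    rw [polFrame, smul_comm, ← ((hE x hx0 A).1 hA).height_smul_eq hε hδ hx0, inv_smul_smul₀ h1]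

theorem height_ne_zero_union :
    {x : Fin 3 → ℝ | height 1 x ≠ 0} ∪ {x | height (-1) x ≠ 0} = {0}ᶜ := by
  ext x
  constructor
  · rintro (h | h) <;> exact ne_zero_of_height_ne_zero h
  · intro hx
    have := height_pow_add_pos hx
    by_contra! h
    simp at h
    simp [h] at this

theorem height_pow_add_ne_zero {x : Fin 3 → ℝ} (hx : x ≠ 0) :
    (4 * (height 1 x ^ 4 + height (-1) x ^ 4) : ℂ) ≠ 0 := by
  have := (height_pow_add_pos hx).ne'
  simp only [ne_eq, mul_eq_zero, OfNat.ofNat_ne_zero, false_or]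
  exact_mod_cast this

/-- Multiples of the `polTensor ε δ`, smooth at all `x ≠ 0`, which decompose the tensors of helicity
`2ε` by means of the functionals `quadForm (refVector ε δ)`. -/
noncomputable def polWeighted (ε δ : ℝ) (x : Fin 3 → ℝ) : Matrix (Fin 3) (Fin 3) ℂ :=
  (4 * (height 1 x ^ 4 + height (-1) x ^ 4) : ℂ)⁻¹ • polTensor ε δ x

theorem contDiffAt_polWeighted {x : Fin 3 → ℝ} (hx : x ≠ 0) (ε δ : ℝ) :
    @ContDiffAt ℝ _ _ _ _ (Matrix (Fin 3) (Fin 3) ℂ) _ NormedSpace.complexToReal ∞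
      (polWeighted ε δ) x :=
  contDiffAt_smul_polTensor hx ((contDiffAt_const.mul (((contDiffAt_height hx 1).pow 4).add
    ((contDiffAt_height hx (-1)).pow 4))).inv (height_pow_add_ne_zero hx)) ε δ

theorem IsCircularTensor.eq_add_polWeighted (hε : ε ^ 2 = 1) {x : Fin 3 → ℝ} (hx : x ≠ 0)
    {A : Matrix (Fin 3) (Fin 3) ℂ} (hA : IsCircularTensor ε x A) :
    quadForm (refVector ε 1) A • polWeighted ε 1 x +
      quadForm (refVector ε (-1)) A • polWeighted ε (-1) x = A := by
  rw [polWeighted, polWeighted, smul_comm _ _ (polTensor ε 1 x), smul_comm _ _ (polTensor ε (-1) x),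
    ← hA.height_smul_eq hε (by norm_num) hx, ← hA.height_smul_eq hε (by norm_num) hx, ← smul_add,
    ← add_smul, ← mul_add, inv_smul_smul₀ (height_pow_add_ne_zero hx)]

theorem euclideanNorm_spherePoint (θ φ : ℝ) : euclideanNorm (spherePoint θ φ) = 1 := by
  have h : spherePoint θ φ ⬝ᵥ spherePoint θ φ = 1 := by
    simp [spherePoint, dotProduct, Fin.sum_univ_three]
    linear_combination (Real.sin θ) ^ 2 * Real.sin_sq_add_cos_sq φ + Real.sin_sq_add_cos_sq θ
  rw [euclideanNorm, h, Real.sqrt_one]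

theorem height_spherePoint (δ θ φ : ℝ) : height δ (spherePoint θ φ) = 1 + δ * Real.cos θ := by
  rw [height, euclideanNorm_spherePoint]
  rfl

theorem isFirstChernNumber_circular (hε : ε ^ 2 = 1)
    (hE : ∀ x ≠ 0, ∀ A, A ∈ E x ↔ IsCircularTensor ε x A) {c : ℤ} (hc : (c : ℝ) = -4 * ε) :
    IsFirstChernNumber E c := by
  have h1 : (1 : ℝ) ^ 2 = 1 := by norm_num
  have h2 : (-1 : ℝ) ^ 2 = 1 := by norm_num
  refine isFirstChernNumber_of_isLineFrame (isLineFrame_polFrame hε h1 hE)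
    (isLineFrame_polFrame hε h2 hE) height_ne_zero_union ?_ ?_ ?_
    (w₀ := polWeighted ε 1) (w₁ := polWeighted ε (-1))
    (fun x hx => ⟨contDiffAt_polWeighted hx ε 1, (E x).smul_mem _
      ((hE x hx _).2 (isCircularTensor_polTensor hε h1 x))⟩)
    (fun x hx => ⟨contDiffAt_polWeighted hx ε (-1), (E x).smul_mem _
      ((hE x hx _).2 (isCircularTensor_polTensor hε h2 x))⟩)
    (fun x hx A hA => ((hE x hx A).1 hA).eq_add_polWeighted hε hx)
  · intro θ hθ φ
    have := Real.cos_nonneg_of_mem_Icc (x := θ) ⟨by linarith [hθ.1, Real.pi_pos], hθ.2⟩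
    rw [Set.mem_ofPred_eq, height_spherePoint]
    linarith
  · intro θ hθ φ
    have := Real.cos_nonpos_of_pi_div_two_le_of_le hθ.1 (by linarith [hθ.2, Real.pi_pos])
    rw [Set.mem_ofPred_eq, height_spherePoint]
    linarith
  · intro φ
    have hh : ∀ δ, height δ (spherePoint (Real.pi / 2) φ) = 1 := fun δ => by
      rw [height_spherePoint, Real.cos_pi_div_two, mul_zero, add_zero]
    have h3 := polTensor_neg hε h1 (spherePoint (Real.pi / 2) φ)
    rw [hh, ofReal_one, one_pow, one_smul] at h3
    change quadForm _ _ = _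
    rw [polFrame, hh, h3, smul_smul, quadForm_smul, quadForm_polTensor hε h1, hh]
    have h4 : planar (-(ε * 1)) (spherePoint (Real.pi / 2) φ) = cexp (-(I * ε * φ)) := by
      rw [exp_neg_I_mul hε]
      simp [planar, spherePoint]
      ring
    have hcC : (c : ℂ) = -4 * ε := by exact_mod_cast congrArg Complex.ofReal hc
    rw [h4, ← Complex.exp_nat_mul, hcC]
    simp
    ring_nf

theorem isSmoothBundle_circular (hε : ε ^ 2 = 1)
    (hE : ∀ x ≠ 0, ∀ A, A ∈ E x ↔ IsCircularTensor ε x A) : IsSmoothBundle 1 {0}ᶜ E := by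
  intro x hx
  rw [← height_ne_zero_union] at hx
  rcases hx with hx | hx
  · exact (isLineFrame_polFrame hε (by norm_num) hE).exists_smooth_frame
      (fun y hy => ne_zero_of_height_ne_zero hy) hx
  · exact (isLineFrame_polFrame hε (by norm_num) hE).exists_smooth_frame
      (fun y hy => ne_zero_of_height_ne_zero hy) hx

end Frames

/-! ### The global frame of the graviton bundle -/

section Graviton

open Complex

theorem spatialPart_lightconePoint (x : Fin 3 → ℝ) : spatialPart (lightconePoint x) = x := by
  ext i
  simp [spatialPart, lightconePoint]

theorem mem_rightGraviton_iff {k : Fin 4 → ℝ} (hk : spatialPart k ≠ 0)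
    (A : Matrix (Fin 3) (Fin 3) ℂ) :
    A ∈ rightGraviton k ↔ IsCircularTensor 1 (spatialPart k) A :=
  mem_helicityGraviton_iff (by norm_num) (by norm_num) hk A

theorem mem_leftGraviton_iff {k : Fin 4 → ℝ} (hk : spatialPart k ≠ 0)
    (A : Matrix (Fin 3) (Fin 3) ℂ) :
    A ∈ leftGraviton k ↔ IsCircularTensor (-1) (spatialPart k) A :=
  mem_helicityGraviton_iff (by norm_num) (by norm_num) hk A

theorem IsCircularTensor.mem_graviton {ε : ℝ} (hε : ε = 1 ∨ ε = -1) {k : Fin 4 → ℝ}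
    (hk : spatialPart k ≠ 0) {A : Matrix (Fin 3) (Fin 3) ℂ}
    (hA : IsCircularTensor ε (spatialPart k) A) : A ∈ graviton k := by
  rcases hε with rfl | rfl
  · exact ((mem_rightGraviton_iff hk A).2 hA).1
  · exact ((mem_leftGraviton_iff hk A).2 hA).1

/-- The component of helicity `2ε` of a tensor. -/
noncomputable def circularPart (ε : ℝ) (x : Fin 3 → ℝ) (A : Matrix (Fin 3) (Fin 3) ℂ) :
    Matrix (Fin 3) (Fin 3) ℂ :=
  (1 / 2 : ℂ) • (A + (I * ε / euclideanNorm x) • (crossMatrix x * A))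

theorem circularPart_add (x : Fin 3 → ℝ) (A : Matrix (Fin 3) (Fin 3) ℂ) :
    circularPart 1 x A + circularPart (-1) x A = A := by
  simp only [circularPart, ofReal_one, ofReal_neg]
  module

theorem isCircularTensor_circularPart {ε : ℝ} (hε : ε ^ 2 = 1) {k : Fin 4 → ℝ}
    (hk : spatialPart k ≠ 0) {A : Matrix (Fin 3) (Fin 3) ℂ} (hA : A ∈ graviton k) :
    IsCircularTensor ε (spatialPart k) (circularPart ε (spatialPart k) A) := by
  obtain ⟨hsym, htr, hker⟩ := hA
  set x := spatialPart k
  have hr : (euclideanNorm x : ℂ) ≠ 0 := by exact_mod_cast (euclideanNorm_pos hk).ne'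
  have hεC : (ε : ℂ) ^ 2 = 1 := by exact_mod_cast hε
  have hK := transpose_crossMatrix_mul hsym htr hker
  have hKK : crossMatrix x * (crossMatrix x * A) = -(euclideanNorm x : ℂ) ^ 2 • A := by
    have h1 : Matrix.vecMulVec (fun i => (x i : ℂ)) (fun i => (x i : ℂ)) * A = 0 := by
      rw [← Matrix.transpose_inj, Matrix.transpose_mul, Matrix.transpose_vecMulVec, hsym,
        Matrix.mul_vecMulVec, hker, Matrix.zero_vecMulVec, Matrix.transpose_zero]
    rw [← Matrix.mul_assoc, crossMatrix_mul_self, Matrix.sub_mul, h1, Matrix.smul_mul,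
      Matrix.one_mul, zero_sub, neg_smul]
  constructor
  · rw [circularPart, Matrix.transpose_smul, Matrix.transpose_add, Matrix.transpose_smul, hK, hsym]
  · rw [circularPart, Matrix.mul_smul, Matrix.mul_add, Matrix.mul_smul, hKK]
    have h1 : I * ε / euclideanNorm x * -(euclideanNorm x : ℂ) ^ 2 =
        -(I * ε * euclideanNorm x) := by
      field_simp
    have h2 : -(I * ε * euclideanNorm x) * (I * ε / euclideanNorm x) = 1 := by
      field_simp
      rw [I_sq, hεC]
      ring
    rw [smul_smul, h1]
    have h3 : crossMatrix x * A = (-(I * ε * euclideanNorm x) * (I * ε / euclideanNorm x)) •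
        (crossMatrix x * A) := by rw [h2, one_smul]
    conv_lhs => rw [h3]
    module

/-- A global frame of the graviton bundle: with a spinor `(z, w)` of `x`, and tensors `s₊`
and `s₋` of helicity `±2`, of degree `4` in `(z, w)` resp. `(z̄, w̄)`, it consists of the tensors
`z̄⁴ s₊ - w⁴ s₋` and `w̄⁴ s₊ + z⁴ s₋`, which depend only on `x`. -/
noncomputable def gravitonFrame (i : Fin 2) (x : Fin 3 → ℝ) : Matrix (Fin 3) (Fin 3) ℂ :=
  ![polTensor 1 1 x - polTensor (-1) (-1) x, polTensor 1 (-1) x + polTensor (-1) 1 x] i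

/-- The complex conjugate of `gravitonFrame`, which is orthogonal. -/
noncomputable def gravitonDual (i : Fin 2) (x : Fin 3 → ℝ) : Matrix (Fin 3) (Fin 3) ℂ :=
  ![polTensor (-1) 1 x - polTensor 1 (-1) x, polTensor (-1) (-1) x + polTensor 1 1 x] i

/-- The squared length of the tensors in `gravitonFrame`. -/
noncomputable def gravitonNormSq (x : Fin 3 → ℝ) : ℂ :=
  64 * euclideanNorm x ^ 4 * (height 1 x ^ 4 + height (-1) x ^ 4)

theorem gravitonNormSq_ne_zero {x : Fin 3 → ℝ} (hx : x ≠ 0) : gravitonNormSq x ≠ 0 := by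
  have h := height_pow_add_pos hx
  have hr := euclideanNorm_pos hx
  have : 64 * euclideanNorm x ^ 4 * (height 1 x ^ 4 + height (-1) x ^ 4) ≠ 0 := by positivity
  unfold gravitonNormSq
  exact_mod_cast this

/-- The coordinates with respect to `gravitonFrame`. -/
noncomputable def gravitonCoord (x : Fin 3 → ℝ) (A : Matrix (Fin 3) (Fin 3) ℂ) (i : Fin 2) : ℂ :=
  (gravitonNormSq x)⁻¹ * (gravitonDual i x * A).trace

theorem gravitonCoord_add (x : Fin 3 → ℝ) (A B : Matrix (Fin 3) (Fin 3) ℂ) :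
    gravitonCoord x (A + B) = gravitonCoord x A + gravitonCoord x B := by
  ext i
  simp [gravitonCoord, mul_add]

theorem gravitonCoord_smul (x : Fin 3 → ℝ) (c : ℂ) (A : Matrix (Fin 3) (Fin 3) ℂ) :
    gravitonCoord x (c • A) = c • gravitonCoord x A := by
  ext i
  simp [gravitonCoord]
  ring

theorem trace_vecMulVec_mul (v w : Fin 3 → ℂ) :
    (Matrix.vecMulVec v v * Matrix.vecMulVec w w).trace = (v ⬝ᵥ w) ^ 2 := by
  rw [Matrix.vecMulVec_mul_vecMulVec, Matrix.trace_vecMulVec, dotProduct_smul, sq]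
  rfl

theorem trace_gravitonDual_mul (i j : Fin 2) (x : Fin 3 → ℝ) :
    (gravitonDual i x * gravitonFrame j x).trace = if i = j then gravitonNormSq x else 0 := by
  have h1 : (1 : ℝ) ^ 2 = 1 := by norm_num
  have h2 : (-1 : ℝ) ^ 2 = 1 := by norm_num
  have n1 := polVector_dotProduct_neg h1 h1 x
  have n2 := polVector_dotProduct_neg h1 h2 x
  have n3 := polVector_dotProduct_neg h2 h1 x
  have n4 := polVector_dotProduct_neg h2 h2 x
  have d1 := polVector_dotProduct_neg_neg h1 h1 x
  have d2 := polVector_dotProduct_neg_neg h1 h2 x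
  have d3 := polVector_dotProduct_neg_neg h2 h1 x
  have d4 := polVector_dotProduct_neg_neg h2 h2 x
  have s1 := polVector_dotProduct_self h1 h1 x
  have s2 := polVector_dotProduct_self h1 h2 x
  have s3 := polVector_dotProduct_self h2 h1 x
  have s4 := polVector_dotProduct_self h2 h2 x
  have t1 := polVector_dotProduct_self_neg h1 h1 x
  have t2 := polVector_dotProduct_self_neg h1 h2 x
  have t3 := polVector_dotProduct_self_neg h2 h1 x
  have t4 := polVector_dotProduct_self_neg h2 h2 x
  simp only [neg_neg, mul_one, mul_neg] at *
  fin_cases i <;> fin_cases j <;>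
    simp [gravitonDual, gravitonFrame, polTensor, sub_mul, mul_sub, add_mul, mul_add,
      trace_vecMulVec_mul, gravitonNormSq, *] <;> ring

theorem gravitonCoord_sum {x : Fin 3 → ℝ} (hx : x ≠ 0) (z : Fin 2 → ℂ) :
    gravitonCoord x (∑ i, z i • gravitonFrame i x) = z := by
  have h := gravitonNormSq_ne_zero hx
  have h1 := fun i j => trace_gravitonDual_mul i j x
  rw [Fin.sum_univ_two]
  ext i
  fin_cases i <;> simp [gravitonCoord, mul_add, h1] <;> field_simp

theorem polTensor_mem_span {x : Fin 3 → ℝ} (hx : x ≠ 0) {ε δ : ℝ} (hε : ε = 1 ∨ ε = -1)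
    (hδ : δ = 1 ∨ δ = -1) :
    polTensor ε δ x ∈ Submodule.span ℂ (Set.range fun i => gravitonFrame i x) := by
  have h1 : (1 : ℝ) ^ 2 = 1 := by norm_num
  have h2 : (-1 : ℝ) ^ 2 = 1 := by norm_num
  have hN : ((height 1 x ^ 4 + height (-1) x ^ 4 : ℂ)) ≠ 0 := by
    exact_mod_cast (height_pow_add_pos hx).ne'
  have e0 := Submodule.subset_span (R := ℂ) (Set.mem_range_self (f := fun i => gravitonFrame i x) 0)
  have e1 := Submodule.subset_span (R := ℂ) (Set.mem_range_self (f := fun i => gravitonFrame i x) 1)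
  have key : ∀ (a b : ℂ) (T : Matrix (Fin 3) (Fin 3) ℂ),
      (height 1 x ^ 4 + height (-1) x ^ 4 : ℂ) • T = a • gravitonFrame 0 x + b • gravitonFrame 1 x →
      T ∈ Submodule.span ℂ (Set.range fun i => gravitonFrame i x) := by
    intro a b T h
    rw [← Submodule.smul_mem_iff _ hN, h]
    exact Submodule.add_mem _ (Submodule.smul_mem _ a e0) (Submodule.smul_mem _ b e1)
  have p1 := polTensor_neg h1 h1 x
  have p2 := polTensor_neg h1 h2 x
  have p3 := polTensor_neg h2 h1 x
  have p4 := polTensor_neg h2 h2 x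
  simp only [neg_neg, mul_one, mul_neg] at p1 p2 p3 p4
  rcases hε with rfl | rfl <;> rcases hδ with rfl | rfl
  · refine key (height 1 x ^ 4) (planar 1 x ^ 4) _ ?_
    simp only [gravitonFrame, Matrix.cons_val_zero, Matrix.cons_val_one]
    linear_combination (norm := module) p2 + p3
  · refine key (planar (-1) x ^ 4) (height (-1) x ^ 4) _ ?_
    simp only [gravitonFrame, Matrix.cons_val_zero, Matrix.cons_val_one]
    linear_combination (norm := module) p1 - p4
  · refine key (-planar (-1) x ^ 4) (height 1 x ^ 4) _ ?_
    simp only [gravitonFrame, Matrix.cons_val_zero, Matrix.cons_val_one]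
    linear_combination (norm := module) p4 - p1
  · refine key (-height (-1) x ^ 4) (planar 1 x ^ 4) _ ?_
    simp only [gravitonFrame, Matrix.cons_val_zero, Matrix.cons_val_one]
    linear_combination (norm := module) p2 + p3

theorem span_gravitonFrame {k : Fin 4 → ℝ} (hk : spatialPart k ≠ 0) :
    Submodule.span ℂ (Set.range fun i => gravitonFrame i (spatialPart k)) = graviton k := by
  have h1 : (1 : ℝ) ^ 2 = 1 := by norm_num
  have h2 : (-1 : ℝ) ^ 2 = 1 := by norm_num
  have hT : ∀ {ε δ : ℝ}, (ε = 1 ∨ ε = -1) → (δ = 1 ∨ δ = -1) →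
      polTensor ε δ (spatialPart k) ∈ graviton k := fun {ε δ} hε hδ =>
    (isCircularTensor_polTensor (sq_eq_one_iff.2 hε) (sq_eq_one_iff.2 hδ) _).mem_graviton hε hk
  apply le_antisymm
  · rw [Submodule.span_le]
    rintro _ ⟨i, rfl⟩
    fin_cases i
    · exact (graviton k).sub_mem (hT (.inl rfl) (.inl rfl)) (hT (.inr rfl) (.inr rfl))
    · exact (graviton k).add_mem (hT (.inl rfl) (.inr rfl)) (hT (.inr rfl) (.inl rfl))
  · intro A hA
    have hC : ∀ {ε : ℝ}, (ε = 1 ∨ ε = -1) → ∀ B, IsCircularTensor ε (spatialPart k) B →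
        B ∈ Submodule.span ℂ (Set.range fun i => gravitonFrame i (spatialPart k)) := by
      intro ε hε B hB
      rw [← hB.eq_add_polWeighted (sq_eq_one_iff.2 hε) hk]
      exact Submodule.add_mem _
        (Submodule.smul_mem _ _ (Submodule.smul_mem _ _ (polTensor_mem_span hk hε (.inl rfl))))
        (Submodule.smul_mem _ _ (Submodule.smul_mem _ _ (polTensor_mem_span hk hε (.inr rfl))))
    rw [← circularPart_add (spatialPart k) A]
    exact Submodule.add_mem _
      (hC (.inl rfl) _ (isCircularTensor_circularPart h1 hk hA))
      (hC (.inr rfl) _ (isCircularTensor_circularPart h2 hk hA))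

theorem sum_gravitonCoord_smul {k : Fin 4 → ℝ} (hk : spatialPart k ≠ 0)
    {A : Matrix (Fin 3) (Fin 3) ℂ} (hA : A ∈ graviton k) :
    ∑ i, gravitonCoord (spatialPart k) A i • gravitonFrame i (spatialPart k) = A := by
  rw [← span_gravitonFrame hk, Submodule.mem_span_range_iff_exists_fun] at hA
  obtain ⟨z, rfl⟩ := hA
  rw [gravitonCoord_sum hk]

theorem isSmoothBundle_graviton :
    IsSmoothBundle 2 {0}ᶜ (fun x => graviton (lightconePoint x)) := by
  intro x hx
  refine ⟨{0}ᶜ, isOpen_compl_singleton, hx, le_rfl, gravitonFrame, fun i y hy => ?_,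
    fun y hy => ⟨?_, ?_⟩⟩
  · refine ContDiffAt.contDiffWithinAt (contDiffAt_matrix fun a b => ?_)
    have h : ∀ ε δ, ContDiffAt ℝ ∞ (fun z => polTensor ε δ z a b) y := fun ε δ =>
      (contDiffAt_polVector hy ε δ a).mul (contDiffAt_polVector hy ε δ b)
    fin_cases i
    · exact (h 1 1).sub (h (-1) (-1))
    · exact (h 1 (-1)).add (h (-1) 1)
  · rw [Fintype.linearIndependent_iff]
    intro z hz
    have := gravitonCoord_sum hy z
    have h0 : gravitonCoord y 0 = 0 := by
      ext i
      simp [gravitonCoord]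
    rw [hz, h0] at this
    exact fun i => (congrFun this i).symm
  · have h := span_gravitonFrame (k := lightconePoint y) (by rwa [spatialPart_lightconePoint])
    rwa [spatialPart_lightconePoint] at h

end Graviton

/-! ### Topological triviality of the graviton bundle -/

section Trivial

open Complex

theorem spatialPart_ne_zero {k : Fin 4 → ℝ} (hk : k ∈ forwardLightcone) : spatialPart k ≠ 0 := by
  intro h
  have h1 : k 1 = 0 := congrFun h 0
  have h2 : k 2 = 0 := congrFun h 1
  have h3 : k 3 = 0 := congrFun h 2
  have h4 := hk.1
  have h5 := hk.2
  rw [h1, h2, h3] at h4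
  nlinarith

theorem lightconePoint_mem {x : Fin 3 → ℝ} (hx : x ≠ 0) : lightconePoint x ∈ forwardLightcone := by
  have h := euclideanNorm_sq x
  refine ⟨?_, euclideanNorm_pos hx⟩
  change -(euclideanNorm x) ^ 2 + x 0 ^ 2 + x 1 ^ 2 + x 2 ^ 2 = 0
  linarith

theorem continuous_lightconePoint : Continuous lightconePoint := by
  refine continuous_pi fun i => ?_
  refine Fin.cases ?_ (fun j => ?_) i
  · change Continuous fun x : Fin 3 → ℝ => Real.sqrt (x ⬝ᵥ x)
    unfold dotProduct
    fun_prop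
  · exact continuous_apply j

theorem continuous_spatialPart : Continuous spatialPart :=
  continuous_pi fun i => continuous_apply i.succ

/-- A continuous global frame, with continuous coordinates, trivializes a bundle. -/
theorem isTopologicallyTrivial_of_frame {X V : Type*} [TopologicalSpace X] [NormedAddCommGroup V]
    [NormedSpace ℂ V] {r : ℕ} {B : Set X} {E : X → Submodule ℂ V} (e : Fin r → X → V)
    (c : X → V → Fin r → ℂ) (he : ∀ i, Continuous fun b : B => e i b)
    (hc : Continuous fun p : B × V => c p.1 p.2) (hmem : ∀ i, ∀ b ∈ B, e i b ∈ E b)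
    (hadd : ∀ b v w, c b (v + w) = c b v + c b w) (hsmul : ∀ b (z : ℂ) v, c b (z • v) = z • c b v)
    (hce : ∀ b ∈ B, ∀ z : Fin r → ℂ, c b (∑ i, z i • e i b) = z)
    (hec : ∀ b ∈ B, ∀ v ∈ E b, ∑ i, c b v i • e i b = v) : IsTopologicallyTrivial r B E := by
  refine ⟨
    { toFun := fun p => (⟨p.1.1, p.2.1⟩, c p.1.1 p.1.2)
      invFun := fun q => ⟨(q.1, ∑ i, q.2 i • e i q.1), q.1.2,
        show ∑ i, q.2 i • e i q.1 ∈ E q.1 from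
          (E q.1).sum_mem fun i _ => (E q.1).smul_mem _ (hmem i q.1 q.1.2)⟩
      left_inv := ?_
      right_inv := ?_
      continuous_toFun := ?_
      continuous_invFun := ?_ }, fun p => rfl, fun b hb => ⟨fun v w => hadd _ _ _,
        fun z v => hsmul _ _ _⟩⟩
  · rintro ⟨⟨b, v⟩, hb, hv⟩
    exact Subtype.ext (Prod.ext rfl (hec b hb v hv))
  · rintro ⟨⟨b, hb⟩, z⟩
    exact Prod.ext rfl (hce b hb z)
  · have h1 : Continuous fun p : BundleTotalSpace B E => (⟨p.1.1, p.2.1⟩ : B) :=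
      (continuous_fst.comp continuous_subtype_val).subtype_mk _
    exact h1.prodMk (hc.comp (h1.prodMk (continuous_snd.comp continuous_subtype_val)))
  · refine Continuous.subtype_mk ?_ _
    refine (continuous_subtype_val.comp continuous_fst).prodMk
      (continuous_finsetSum _ fun i _ => ?_)
    exact ((continuous_apply i).comp continuous_snd).smul ((he i).comp continuous_fst)

theorem continuous_polTensor_comp {ε δ : ℝ} {Y : Type*} [TopologicalSpace Y] {f : Y → Fin 3 → ℝ}
    (hf : Continuous f) (hf0 : ∀ y, f y ≠ 0) : Continuous fun y => polTensor ε δ (f y) := by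
  refine continuous_matrix fun i j => continuous_iff_continuousAt.2 fun y => ?_
  exact (((contDiffAt_polVector (hf0 y) ε δ i).mul
    (contDiffAt_polVector (hf0 y) ε δ j)).continuousAt).comp (f := f) hf.continuousAt

theorem isTopologicallyTrivial_graviton : IsTopologicallyTrivial 2 forwardLightcone graviton := by
  have hT : ∀ ε δ, Continuous fun b : forwardLightcone => polTensor ε δ (spatialPart b) :=
    fun ε δ => continuous_polTensor_comp (continuous_spatialPart.comp continuous_subtype_val)
      fun b => spatialPart_ne_zero b.2
  refine isTopologicallyTrivial_of_frame (fun i k => gravitonFrame i (spatialPart k))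
    (fun k => gravitonCoord (spatialPart k)) ?_ ?_ ?_ (fun k => gravitonCoord_add _)
    (fun k => gravitonCoord_smul _) (fun k hk => gravitonCoord_sum (spatialPart_ne_zero hk))
    (fun k hk A hA => sum_gravitonCoord_smul (spatialPart_ne_zero hk) hA)
  · intro i
    fin_cases i
    · exact (hT 1 1).sub (hT (-1) (-1))
    · exact (hT 1 (-1)).add (hT (-1) 1)
  · refine continuous_pi fun i => ?_
    have h1 : Continuous fun b : forwardLightcone => gravitonDual i (spatialPart b) := by
      fin_cases i
      · exact (hT (-1) 1).sub (hT 1 (-1))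
      · exact (hT (-1) (-1)).add (hT 1 1)
    have h2 : Continuous fun b : forwardLightcone => (gravitonNormSq (spatialPart b))⁻¹ := by
      refine Continuous.inv₀ ?_ fun b => gravitonNormSq_ne_zero (spatialPart_ne_zero b.2)
      have h3 : Continuous fun b : forwardLightcone => spatialPart b :=
        continuous_spatialPart.comp continuous_subtype_val
      unfold gravitonNormSq height euclideanNorm dotProduct
      fun_prop
    exact (h2.comp continuous_fst).mul
      ((h1.comp continuous_fst).matrix_mul continuous_snd).matrix_trace
  · intro i k hk
    rw [← span_gravitonFrame (spatialPart_ne_zero hk)]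
    exact Submodule.subset_span (Set.mem_range_self i)

end Trivial

/-! ### Winding numbers and nontriviality -/

section Winding

open Complex

theorem eq_of_exp_comp_eq {g : ℝ → ℂ} (hg : Continuous g) (h : ∀ a b, cexp (g a) = cexp (g b))
    (a b : ℝ) : g a = g b :=
  Complex.isCoveringMap_exp.const_of_comp hg (fun a b => Subtype.ext (h a b)) a b

/-- In a homotopy of loops in `ℂ ∖ {0}` the winding number does not change. -/
theorem winding_eq {f : ℝ × ℝ → ℂ} (hf : Continuous f) (hf0 : ∀ q, f q ≠ 0)
    (hper : ∀ θ, f (θ, 2 * Real.pi) = f (θ, 0)) {a b n m : ℝ}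
    (ha : ∀ φ : ℝ, f (a, φ) = cexp (I * n * φ) * f (a, 0))
    (hb : ∀ φ : ℝ, f (b, φ) = cexp (I * m * φ) * f (b, 0)) : n = m := by
  obtain ⟨L, ⟨-, hL⟩, -⟩ := Complex.isCoveringMapOn_exp.existsUnique_continuousMap_lifts
    ⟨f, hf⟩ (a₀ := (0, 0)) (e₀ := Complex.log (f (0, 0))) (exp_log (hf0 _)) hf0
  have hL' : ∀ q, cexp (L q) = f q := fun q => congrFun hL q
  have hd := eq_of_exp_comp_eq (g := fun θ => L (θ, 2 * Real.pi) - L (θ, 0))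
    (by fun_prop) (fun x y => by simp [exp_sub, hL', hper, hf0]) a b
  have key : ∀ {c k : ℝ}, (∀ φ : ℝ, f (c, φ) = cexp (I * k * φ) * f (c, 0)) →
      L (c, 2 * Real.pi) - L (c, 0) = I * k * (2 * Real.pi) := by
    intro c k hk
    have h := eq_of_exp_comp_eq (g := fun φ : ℝ => L (c, φ) - I * k * φ) (by fun_prop)
      (fun x y => by
        simp only [exp_sub, hL']
        rw [hk x, hk y]
        field_simp [exp_ne_zero]) (2 * Real.pi) 0
    push_cast at h
    linear_combination h
  have h1 : I * n * (2 * Real.pi) = I * m * (2 * Real.pi) := by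
    rw [← key ha, ← key hb]
    exact hd
  have hpi : (Real.pi : ℂ) ≠ 0 := by exact_mod_cast Real.pi_ne_zero
  have h2 : (n : ℂ) = m := by
    apply mul_left_cancel₀ (mul_ne_zero I_ne_zero (mul_ne_zero two_ne_zero hpi))
    linear_combination h1
  exact_mod_cast h2

/-- The circularly polarized vector `e_θ + iε e_φ` in spherical coordinates. It is continuous in the
coordinates, but at the poles `θ = 0, π` it depends on `φ`. -/
noncomputable def sphereVector (ε θ φ : ℝ) : Fin 3 → ℂ :=
  ![Real.cos θ * Real.cos φ - I * ε * Real.sin φ, Real.cos θ * Real.sin φ + I * ε * Real.cos φ,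
    -Real.sin θ]

theorem isCircularVector_sphereVector {ε : ℝ} (hε : ε ^ 2 = 1) (θ φ : ℝ) :
    IsCircularVector ε (spherePoint θ φ) (sphereVector ε θ φ) := by
  have hεC : (ε : ℂ) ^ 2 = 1 := by exact_mod_cast hε
  have hI := I_sq
  have h1 : (Real.sin θ : ℂ) ^ 2 + Real.cos θ ^ 2 = 1 := by
    exact_mod_cast Real.sin_sq_add_cos_sq θ
  have h2 : (Real.sin φ : ℂ) ^ 2 + Real.cos φ ^ 2 = 1 := by
    exact_mod_cast Real.sin_sq_add_cos_sq φ
  rw [IsCircularVector, crossMatrix_mulVec, euclideanNorm_spherePoint]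
  ext i
  fin_cases i <;> simp [spherePoint, sphereVector, -ofReal_sin, -ofReal_cos] <;> grind

theorem sphereVector_neg_dotProduct {ε : ℝ} (hε : ε ^ 2 = 1) (θ φ : ℝ) :
    sphereVector (-ε) θ φ ⬝ᵥ sphereVector ε θ φ = 2 := by
  have hεC : (ε : ℂ) ^ 2 = 1 := by exact_mod_cast hε
  have hI := I_sq
  have h1 : (Real.sin θ : ℂ) ^ 2 + Real.cos θ ^ 2 = 1 := by
    exact_mod_cast Real.sin_sq_add_cos_sq θ
  have h2 : (Real.sin φ : ℂ) ^ 2 + Real.cos φ ^ 2 = 1 := by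
    exact_mod_cast Real.sin_sq_add_cos_sq φ
  simp [sphereVector, dotProduct, Fin.sum_univ_three, -ofReal_sin, -ofReal_cos]
  grind

theorem continuous_sphereVector (ε : ℝ) :
    Continuous fun q : ℝ × ℝ => sphereVector ε q.1 q.2 := by
  refine continuous_pi fun i => ?_
  fin_cases i <;> simp [sphereVector, -ofReal_sin, -ofReal_cos] <;> fun_prop

theorem quadForm_smul_left (c : ℂ) (e : Fin 3 → ℂ) (A : Matrix (Fin 3) (Fin 3) ℂ) :
    quadForm (c • e) A = c ^ 2 * quadForm e A := by
  simp [quadForm, Matrix.mulVec_smul, sq, mul_assoc]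

theorem sphereVector_zero {ε : ℝ} (hε : ε ^ 2 = 1) (φ : ℝ) :
    sphereVector (-ε) 0 φ = cexp (-(I * (-ε : ℝ) * φ)) • sphereVector (-ε) 0 0 := by
  have hεC : (ε : ℂ) ^ 2 = 1 := by exact_mod_cast hε
  have hI := I_sq
  rw [exp_neg_I_mul (by rwa [neg_sq])]
  ext i
  fin_cases i <;> simp [sphereVector, -ofReal_sin, -ofReal_cos] <;> grind

theorem sphereVector_pi {ε : ℝ} (hε : ε ^ 2 = 1) (φ : ℝ) :
    sphereVector (-ε) Real.pi φ = cexp (-(I * ε * φ)) • sphereVector (-ε) Real.pi 0 := by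
  have hεC : (ε : ℂ) ^ 2 = 1 := by exact_mod_cast hε
  have hI := I_sq
  rw [exp_neg_I_mul hε]
  ext i
  fin_cases i <;> simp [sphereVector, -ofReal_sin, -ofReal_cos] <;> grind

/-- A trivialization would give a continuous section without zeros. Its coordinate with respect to
the square of `sphereVector` would be a homotopy in `ℂ ∖ {0}` between loops of winding number `2ε`,
at `θ = 0`, and `-2ε`, at `θ = π`. -/
theorem not_isTopologicallyTrivial_circular {ε : ℝ} (hε : ε ^ 2 = 1)
    {E : (Fin 4 → ℝ) → Submodule ℂ (Matrix (Fin 3) (Fin 3) ℂ)}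
    (hE : ∀ k, spatialPart k ≠ 0 → ∀ A, A ∈ E k ↔ IsCircularTensor ε (spatialPart k) A) :
    ¬ IsTopologicallyTrivial 1 forwardLightcone E := by
  rintro ⟨Φ, hΦ, hlin⟩
  let pt : ℝ × ℝ → forwardLightcone := fun q =>
    ⟨lightconePoint (spherePoint q.1 q.2), lightconePoint_mem (spherePoint_ne_zero _ _)⟩
  have hpt : Continuous pt :=
    (continuous_lightconePoint.comp contDiff_spherePoint.continuous).subtype_mk _
  let S : ℝ × ℝ → BundleTotalSpace forwardLightcone E := fun q => Φ.symm (pt q, fun _ => 1)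
  have hS : Continuous S := Φ.symm.continuous.comp (hpt.prodMk continuous_const)
  have hbase : ∀ q, (S q).1.1 = pt q := fun q => by
    rw [← hΦ (S q), Φ.apply_symm_apply]
  let σ : ℝ × ℝ → Matrix (Fin 3) (Fin 3) ℂ := fun q => (S q).1.2
  have hσ : Continuous σ := continuous_snd.comp (continuous_subtype_val.comp hS)
  have hσE : ∀ q, IsCircularTensor ε (spherePoint q.1 q.2) (σ q) := by
    intro q
    have h := (S q).2.2
    rw [hbase q, hE _ (spatialPart_ne_zero (pt q).2)] at h
    simpa only [pt, spatialPart_lightconePoint] using h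
  have hσ0 : ∀ q, σ q ≠ 0 := by
    intro q hq
    have h1 : S q = ⟨(pt q, (0 : E (pt q)).1), (pt q).2, (0 : E (pt q)).2⟩ :=
      Subtype.ext (Prod.ext (hbase q) hq)
    have h2 := (hlin (pt q) (pt q).2).map_zero
    rw [← h1, Φ.apply_symm_apply] at h2
    exact one_ne_zero (congrFun h2 0)
  have hpt_eq : ∀ {q q' : ℝ × ℝ}, spherePoint q.1 q.2 = spherePoint q'.1 q'.2 → σ q = σ q' := by
    intro q q' h
    have : pt q = pt q' := Subtype.ext (congrArg lightconePoint h)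
    simp only [σ, S, this]
  let f : ℝ × ℝ → ℂ := fun q => quadForm (sphereVector (-ε) q.1 q.2) (σ q)
  have hf : Continuous f :=
    continuous_quadForm.comp ((continuous_sphereVector (-ε)).prodMk hσ)
  have hf0 : ∀ q, f q ≠ 0 := by
    intro q hq
    have h := (hσE q).smul_eq hε (spherePoint_ne_zero _ _)
      (isCircularVector_sphereVector hε q.1 q.2) (sphereVector (-ε) q.1 q.2)
    rw [sphereVector_neg_dotProduct hε, show quadForm _ (σ q) = 0 from hq, zero_smul] at h
    exact hσ0 q ((smul_eq_zero.1 h).resolve_left (by norm_num))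
  have hper : ∀ θ, f (θ, 2 * Real.pi) = f (θ, 0) := by
    intro θ
    have h1 : σ (θ, 2 * Real.pi) = σ (θ, 0) := hpt_eq (by simp [spherePoint])
    simp only [f, h1]
    simp [sphereVector]
  have h0 : ∀ φ : ℝ, f (0, φ) = cexp (I * (2 * ε : ℝ) * φ) * f (0, 0) := by
    intro φ
    have h1 : σ (0, φ) = σ (0, 0) := hpt_eq (by simp [spherePoint])
    simp only [f, h1]
    rw [sphereVector_zero hε φ, quadForm_smul_left, ← Complex.exp_nat_mul]
    push_cast
    ring_nf
  have hpi : ∀ φ : ℝ, f (Real.pi, φ) = cexp (I * (-2 * ε : ℝ) * φ) * f (Real.pi, 0) := by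
    intro φ
    have h1 : σ (Real.pi, φ) = σ (Real.pi, 0) := hpt_eq (by simp [spherePoint])
    simp only [f, h1]
    rw [sphereVector_pi hε φ, quadForm_smul_left, ← Complex.exp_nat_mul]
    push_cast
    ring_nf
  have := winding_eq hf hf0 hper h0 hpi
  nlinarith

end Winding

theorem theorem4 :
    (IsSmoothBundle 2 {0}ᶜ (fun x => graviton (lightconePoint x)) ∧
      IsTopologicallyTrivial 2 forwardLightcone graviton) ∧
    (IsSmoothBundle 1 {0}ᶜ (fun x => rightGraviton (lightconePoint x)) ∧
      ¬ IsTopologicallyTrivial 1 forwardLightcone rightGraviton ∧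
      IsFirstChernNumber (fun x => rightGraviton (lightconePoint x)) (-4)) ∧
    (IsSmoothBundle 1 {0}ᶜ (fun x => leftGraviton (lightconePoint x)) ∧
      ¬ IsTopologicallyTrivial 1 forwardLightcone leftGraviton ∧
      IsFirstChernNumber (fun x => leftGraviton (lightconePoint x)) 4) := by
  have hR : ∀ x ≠ 0, ∀ A, A ∈ rightGraviton (lightconePoint x) ↔ IsCircularTensor 1 x A :=
    fun x hx A => by
      have h := mem_rightGraviton_iff (k := lightconePoint x)
        (by rwa [spatialPart_lightconePoint]) A
      rwa [spatialPart_lightconePoint] at h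
  have hL : ∀ x ≠ 0, ∀ A, A ∈ leftGraviton (lightconePoint x) ↔ IsCircularTensor (-1) x A :=
    fun x hx A => by
      have h := mem_leftGraviton_iff (k := lightconePoint x)
        (by rwa [spatialPart_lightconePoint]) A
      rwa [spatialPart_lightconePoint] at h
  exact ⟨⟨isSmoothBundle_graviton, isTopologicallyTrivial_graviton⟩,
    ⟨isSmoothBundle_circular (by norm_num) hR,
      not_isTopologicallyTrivial_circular (by norm_num) fun k hk A => mem_rightGraviton_iff hk A,
      isFirstChernNumber_circular (by norm_num) hR (by norm_num)⟩,
    ⟨isSmoothBundle_circular (by norm_num) hL,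
      not_isTopologicallyTrivial_circular (by norm_num) fun k hk A => mem_leftGraviton_iff hk A,
      isFirstChernNumber_circular (by norm_num) hL (by norm_num)⟩⟩
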